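/- Let $k$ be a field and let $C$ be a coassociative counital $k$-coalgebra with comultiplication $\mu\colon C\to C\otimes_k C$ and counit $\epsilon\colon C\to k$, endowed with a coaugmentation, i.e., a homomorphism of counital coalgebras $\gamma\colon k\to C$. A right $C$-comodule is a $k$-vector space $N$ with a coassociative and counital coaction $N\to N\otimes_k C$. A left $C$-contramodule is a $k$-vector space $P$ with a $k$-linear contraaction $\pi\colon \operatorname{Hom}_k(C,P)\to P$ such that $\pi(c\mapsto\epsilon(c)p)=p$ for all $p\in P$ (contraunitality) and $\pi\bigl(c\mapsto\pi(c'\mapsto g(c'\otimes c))\bigr)=\pi(g\circ\mu)$ for all linear maps $g\colon C\otimes_kC\to P$ (contraassociativity). Right $C$-comodules and left $C$-contramodules form $k$-linear abelian categories; their Ext spaces are denoted by $\operatorname{Ext}^n_{C^{\mathrm{op}}}$ and $\operatorname{Ext}^{C,n}$, respectively. The coaugmentation makes the vector space $k$ a right $C$-comodule with the coaction $a\mapsto a\otimes\gamma(1)$, and a left $C$-contramodule with the contraaction $g\mapsto g(\gamma(1))$, $g\in\operatorname{Hom}_k(C,k)$. For a vector space $V$ put $V^*=\operatorname{Hom}_k(V,k)$.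 For a right $C$-comodule $N$, the space $N^*$ is a left $C$-contramodule with the contraaction $\operatorname{Hom}_k(C,N^*)\simeq\operatorname{Hom}_k(N\otimes_kC,k)\to\operatorname{Hom}_k(N,k)=N^*$ given by composition with the coaction of $N$; so there is an exact contravariant functor $N\mapsto N^*$ from right $C$-comodules to left $C$-contramodules, and $k^*\simeq k$ as left $C$-contramodules. Then for every $n\ge0$ there is an isomorphism of $k$-vector spaces $$ \operatorname{Ext}^{C,n}(k,k)\simeq\operatorname{Ext}^n_{C^{\mathrm{op}}}(k,k)^{**}, $$ such that: (1) the isomorphism identifies the map $$ \operatorname{Ext}^n_{C^{\mathrm{op}}}(k,k)\longrightarrow\operatorname{Ext}^{C,n}(k^*,k^*)\simeq\operatorname{Ext}^{C,n}(k,k) $$ induced by the exact contravariant functor $N\mapsto N^*$ with the canonical inclusion $\operatorname{Ext}^n_{C^{\mathrm{op}}}(k,k)\to\operatorname{Ext}^n_{C^{\mathrm{op}}}(k,k)^{**}$ of a vector space into its double dual; (2) the isomorphism is natural in $(C,\gamma)$: for every homomorphism of coaugmented coalgebras $f\colon(C,\gamma)\to(C',\gamma')$ (a coalgebra homomorphism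 with $f\gamma=\gamma'$), it identifies the map $\operatorname{Ext}^{C,n}(k,k)\to\operatorname{Ext}^{C',n}(k,k)$ induced by the exact functor of corestriction of contramodules along $f$ with the double dual of the map $\operatorname{Ext}^n_{C^{\mathrm{op}}}(k,k)\to\operatorname{Ext}^n_{C'^{\mathrm{op}}}(k,k)$ induced by the exact functor of corestriction of comodules along $f$. -/

import Mathlib

open CategoryTheory Limits TensorProduct

universe u

section Generic

variable {A : Type*} [Category A] [Preadditive A] [HasFiniteProducts A]
  [HasKernels A] [HasCokernels A] {B : Type*} [Category B] [Abelian B]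

/-- An additive category with kernels and cokernels is abelian as soon as it has a conservative
functor to an abelian category which preserves kernels and cokernels. -/
@[reducible] noncomputable def abelianOfConservative (F : A ⥤ B) [F.PreservesZeroMorphisms]
    [F.ReflectsIsomorphisms]
    (h₁ : ∀ {X Y : A} (f : X ⟶ Y), PreservesLimit (parallelPair f 0) F)
    (h₂ : ∀ {X Y : A} (f : X ⟶ Y), PreservesColimit (parallelPair f 0) F) : Abelian A := by
  have : ∀ {X Y : A} (f : X ⟶ Y), IsIso (Abelian.coimageImageComparison f) := by
    intro X Y f
    have := @h₁
    have := @h₂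
    have : IsIso (F.map (Abelian.coimageImageComparison f)) :=
      (Arrow.isIso_iff_isIso_of_isIso
        (Abelian.PreservesCoimageImageComparison.iso F f).hom).2 inferInstance
    exact isIso_of_reflects_iso _ F
  exact Abelian.ofCoimageImageComparisonIsIso

end Generic

/-- A right comodule `N` over a (coassociative, counital) coalgebra `C` over a field `k`. -/
structure RightComod (k C : Type u) [Field k] [AddCommGroup C] [Module k C] [Coalgebra k C] where
  /-- the underlying vector space -/
  carrier : Type u
  [addCommGroup : AddCommGroup carrier]
  [module : Module k carrier]
  /-- the right coaction `N → N ⊗ C` -/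
  coact : carrier →ₗ[k] carrier ⊗[k] C
  counit_coact : (TensorProduct.rid k carrier).toLinearMap ∘ₗ
    (Coalgebra.counit (R := k) (A := C)).lTensor carrier ∘ₗ coact = LinearMap.id
  coassoc : (TensorProduct.assoc k carrier C C).toLinearMap ∘ₗ coact.rTensor C ∘ₗ coact =
    (Coalgebra.comul (R := k) (A := C)).lTensor carrier ∘ₗ coact

namespace RightComod

variable {k C : Type u} [Field k] [AddCommGroup C] [Module k C] [Coalgebra k C]

attribute [instance] addCommGroup module

/-- The space of comodule homomorphisms: linear maps commuting with the coactions. -/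
def homs (M N : RightComod k C) : Submodule k (M.carrier →ₗ[k] N.carrier) where
  carrier := {f | N.coact ∘ₗ f = f.rTensor C ∘ₗ M.coact}
  add_mem' {f g} hf hg := by
    simp only [Set.mem_ofPred_eq] at *
    rw [LinearMap.comp_add, hf, hg, LinearMap.rTensor_add, LinearMap.add_comp]
  zero_mem' := by simp
  smul_mem' c f hf := by
    simp only [Set.mem_ofPred_eq] at *
    rw [LinearMap.comp_smul, hf, LinearMap.rTensor_smul, LinearMap.smul_comp]

instance : Category (RightComod k C) where
  Hom M N := homs M N
  id M := ⟨LinearMap.id, by simp [homs]⟩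
  comp {M N P} f g := ⟨g.1 ∘ₗ f.1, by
    have hf : N.coact ∘ₗ f.1 = f.1.rTensor C ∘ₗ M.coact := f.2
    have hg : P.coact ∘ₗ g.1 = g.1.rTensor C ∘ₗ N.coact := g.2
    change P.coact ∘ₗ g.1 ∘ₗ f.1 = _
    rw [← LinearMap.comp_assoc, hg, LinearMap.comp_assoc, hf, LinearMap.rTensor_comp,
      LinearMap.comp_assoc]⟩

/-- The linear map underlying a comodule homomorphism. -/
def lin {M N : RightComod k C} (f : M ⟶ N) : M.carrier →ₗ[k] N.carrier := f.1

/-- The comodule homomorphism given by a linear map commuting with the coactions. -/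
def homMk {M N : RightComod k C} (f : M.carrier →ₗ[k] N.carrier)
    (hf : N.coact ∘ₗ f = f.rTensor C ∘ₗ M.coact) : M ⟶ N := ⟨f, hf⟩

lemma lin_comm {M N : RightComod k C} (f : M ⟶ N) :
    N.coact ∘ₗ lin f = (lin f).rTensor C ∘ₗ M.coact := f.2

lemma lin_comm_apply {M N : RightComod k C} (f : M ⟶ N) (m : M.carrier) :
    N.coact (lin f m) = (lin f).rTensor C (M.coact m) := LinearMap.congr_fun (lin_comm f) m

lemma hom_ext {M N : RightComod k C} {f g : M ⟶ N} (h : lin f = lin g) : f = g := Subtype.ext h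

@[simp] lemma lin_homMk {M N : RightComod k C} (f : M.carrier →ₗ[k] N.carrier) (hf) :
    lin (homMk (M := M) (N := N) f hf) = f := rfl

@[simp] lemma lin_id (M : RightComod k C) : lin (𝟙 M) = LinearMap.id := rfl

@[simp] lemma lin_comp {M N P : RightComod k C} (f : M ⟶ N) (g : N ⟶ P) :
    lin (f ≫ g) = lin g ∘ₗ lin f := rfl

instance (M N : RightComod k C) : AddCommGroup (M ⟶ N) :=
  inferInstanceAs (AddCommGroup (homs M N))

instance (M N : RightComod k C) : Module k (M ⟶ N) :=
  inferInstanceAs (Module k (homs M N))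

@[simp] lemma lin_add {M N : RightComod k C} (f g : M ⟶ N) : lin (f + g) = lin f + lin g := rfl
@[simp] lemma lin_zero {M N : RightComod k C} : lin (0 : M ⟶ N) = 0 := rfl
@[simp] lemma lin_smul {M N : RightComod k C} (c : k) (f : M ⟶ N) : lin (c • f) = c • lin f := rfl

instance : Preadditive (RightComod k C) where
  add_comp _ _ _ f f' g := hom_ext (LinearMap.comp_add _ _ _)
  comp_add _ _ _ f g g' := hom_ext (LinearMap.add_comp _ _ _)

instance : Linear k (RightComod k C) where
  smul_comp _ _ _ c f g := hom_ext (LinearMap.comp_smul _ _ _)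
  comp_smul _ _ _ f c g := hom_ext (LinearMap.smul_comp _ _ _)

variable (k C) in
/-- The forgetful functor from comodules to vector spaces. -/
def forget : RightComod k C ⥤ ModuleCat.{u} k where
  obj M := ModuleCat.of k M.carrier
  map f := ModuleCat.ofHom (lin f)

instance : (forget k C).Additive where
instance : (forget k C).Linear k where
instance : (forget k C).Faithful where
  map_injective h := hom_ext (congrArg ModuleCat.Hom.hom h)

instance : (forget k C).ReflectsIsomorphisms where
  reflects {M N} f h := by
    let e := (asIso ((forget k C).map f)).toLinearEquiv
    have he : e.toLinearMap = lin f := rfl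
    have h1 : e.symm.toLinearMap ∘ₗ lin f = LinearMap.id :=
      LinearMap.ext fun x => e.symm_apply_apply x
    have h2 : lin f ∘ₗ e.symm.toLinearMap = LinearMap.id :=
      LinearMap.ext fun x => e.apply_symm_apply x
    let g : N.carrier →ₗ[k] M.carrier := e.symm.toLinearMap
    change g ∘ₗ lin f = _ at h1
    change lin f ∘ₗ g = _ at h2
    refine ⟨homMk g ?_, hom_ext h1, hom_ext h2⟩
    calc M.coact ∘ₗ g
      _ = (g ∘ₗ lin f).rTensor C ∘ₗ M.coact ∘ₗ g := by
          rw [h1]; simp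
      _ = g.rTensor C ∘ₗ ((lin f).rTensor C ∘ₗ M.coact) ∘ₗ g := by
          rw [LinearMap.rTensor_comp]; rfl
      _ = g.rTensor C ∘ₗ N.coact ∘ₗ (lin f ∘ₗ g) := by
          rw [← lin_comm]; rfl
      _ = _ := by rw [h2]; rfl

section nat

variable {V W : Type u} [AddCommGroup V] [Module k V] [AddCommGroup W] [Module k W]
  {c : V →ₗ[k] V ⊗[k] C} {d : W →ₗ[k] W ⊗[k] C} {h : V →ₗ[k] W}

lemma nat_counit (hc : d ∘ₗ h = h.rTensor C ∘ₗ c) (v : V) :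
    TensorProduct.rid k W ((Coalgebra.counit (R := k) (A := C)).lTensor W (d (h v))) =
    h (TensorProduct.rid k V ((Coalgebra.counit (R := k) (A := C)).lTensor V (c v))) := by
  have e := LinearMap.congr_fun hc v
  simp only [LinearMap.comp_apply] at e
  rw [e]
  generalize c v = x
  induction x with
  | zero => simp
  | tmul a b => simp
  | add x y hx hy => simp only [map_add, hx, hy]

set_option linter.unusedSectionVars false in
lemma nat_left (hc : d ∘ₗ h = h.rTensor C ∘ₗ c) (v : V) :
    TensorProduct.assoc k W C C (d.rTensor C (d (h v))) =
    h.rTensor (C ⊗[k] C) (TensorProduct.assoc k V C C (c.rTensor C (c v))) := by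
  have e := fun v => LinearMap.congr_fun hc v
  simp only [LinearMap.comp_apply] at e
  rw [e]
  generalize c v = x
  induction x with
  | zero => simp
  | tmul a b =>
    simp only [LinearMap.rTensor_tmul, e]
    generalize c a = y
    induction y with
    | zero => simp
    | tmul a b => simp
    | add x y hx hy => simp only [map_add, add_tmul, hx, hy]
  | add x y hx hy => simp only [map_add, hx, hy]

lemma nat_right (hc : d ∘ₗ h = h.rTensor C ∘ₗ c) (v : V) :
    (Coalgebra.comul (R := k) (A := C)).lTensor W (d (h v)) =
    h.rTensor (C ⊗[k] C) ((Coalgebra.comul (R := k) (A := C)).lTensor V (c v)) := by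
  have e := LinearMap.congr_fun hc v
  simp only [LinearMap.comp_apply] at e
  rw [e]
  generalize c v = x
  induction x with
  | zero => simp
  | tmul a b => simp
  | add x y hx hy => simp only [map_add, hx, hy]

end nat

lemma counit_apply (M : RightComod k C) (m : M.carrier) : TensorProduct.rid k M.carrier
    ((Coalgebra.counit (R := k) (A := C)).lTensor M.carrier (M.coact m)) = m :=
  LinearMap.congr_fun M.counit_coact m

lemma coassoc_apply (M : RightComod k C) (m : M.carrier) :
    TensorProduct.assoc k M.carrier C C (M.coact.rTensor C (M.coact m)) =
    (Coalgebra.comul (R := k) (A := C)).lTensor M.carrier (M.coact m) :=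
  LinearMap.congr_fun M.coassoc m

/-- The zero comodule. -/
def zero : RightComod k C where
  carrier := PUnit
  coact := 0
  counit_coact := LinearMap.ext fun _ => rfl
  coassoc := by simp

instance : HasZeroObject (RightComod k C) :=
  ⟨zero, ⟨fun M => ⟨⟨⟨0⟩, fun f => hom_ext (LinearMap.ext fun x => by
      rw [show x = 0 from rfl, map_zero, map_zero])⟩⟩,
    fun M => ⟨⟨⟨0⟩, fun f => hom_ext (LinearMap.ext fun x => rfl)⟩⟩⟩⟩

/-- The coaction on the direct sum of two comodules. -/
def prodCoact (M N : RightComod k C) :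
    M.carrier × N.carrier →ₗ[k] (M.carrier × N.carrier) ⊗[k] C :=
  LinearMap.coprod ((LinearMap.inl k M.carrier N.carrier).rTensor C ∘ₗ M.coact)
    ((LinearMap.inr k M.carrier N.carrier).rTensor C ∘ₗ N.coact)

lemma prodCoact_inl (M N : RightComod k C) : prodCoact M N ∘ₗ LinearMap.inl k _ _ =
    (LinearMap.inl k _ _).rTensor C ∘ₗ M.coact := LinearMap.coprod_inl _ _

lemma prodCoact_inr (M N : RightComod k C) : prodCoact M N ∘ₗ LinearMap.inr k _ _ =
    (LinearMap.inr k _ _).rTensor C ∘ₗ N.coact := LinearMap.coprod_inr _ _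

lemma coact_fst (M N : RightComod k C) : M.coact ∘ₗ LinearMap.fst k M.carrier N.carrier =
    (LinearMap.fst k M.carrier N.carrier).rTensor C ∘ₗ prodCoact M N := by
  apply LinearMap.prod_ext
  · rw [LinearMap.comp_assoc, LinearMap.comp_assoc, prodCoact_inl, ← LinearMap.comp_assoc (M.coact),
      ← LinearMap.rTensor_comp]
    simp [LinearMap.fst_comp_inl]
  · rw [LinearMap.comp_assoc, LinearMap.comp_assoc, prodCoact_inr, ← LinearMap.comp_assoc (N.coact),
      ← LinearMap.rTensor_comp]
    simp [LinearMap.fst_comp_inr]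

lemma coact_snd (M N : RightComod k C) : N.coact ∘ₗ LinearMap.snd k M.carrier N.carrier =
    (LinearMap.snd k M.carrier N.carrier).rTensor C ∘ₗ prodCoact M N := by
  apply LinearMap.prod_ext
  · rw [LinearMap.comp_assoc, LinearMap.comp_assoc, prodCoact_inl, ← LinearMap.comp_assoc (M.coact),
      ← LinearMap.rTensor_comp]
    simp [LinearMap.snd_comp_inl]
  · rw [LinearMap.comp_assoc, LinearMap.comp_assoc, prodCoact_inr, ← LinearMap.comp_assoc (N.coact),
      ← LinearMap.rTensor_comp]
    simp [LinearMap.snd_comp_inr]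

/-- The direct sum of two comodules. -/
def prod (M N : RightComod k C) : RightComod k C where
  carrier := M.carrier × N.carrier
  coact := prodCoact M N
  counit_coact := by
    apply LinearMap.prod_ext <;> apply LinearMap.ext <;> intro x
    · exact (nat_counit (prodCoact_inl M N) x).trans (congrArg _ (M.counit_apply x))
    · exact (nat_counit (prodCoact_inr M N) x).trans (congrArg _ (N.counit_apply x))
  coassoc := by
    apply LinearMap.prod_ext <;> apply LinearMap.ext <;> intro x
    · exact (nat_left (prodCoact_inl M N) x).trans
        ((congrArg _ (M.coassoc_apply x)).trans (nat_right (prodCoact_inl M N) x).symm)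
    · exact (nat_left (prodCoact_inr M N) x).trans
        ((congrArg _ (N.coassoc_apply x)).trans (nat_right (prodCoact_inr M N) x).symm)

instance (M N : RightComod k C) : HasBinaryBiproduct M N := by
  let b : BinaryBicone M N :=
    { pt := prod M N
      fst := homMk (LinearMap.fst k _ _) (coact_fst M N)
      snd := homMk (LinearMap.snd k _ _) (coact_snd M N)
      inl := homMk (LinearMap.inl k _ _) (prodCoact_inl M N)
      inr := homMk (LinearMap.inr k _ _) (prodCoact_inr M N)
      inl_fst := hom_ext (LinearMap.ext fun x => rfl)
      inl_snd := hom_ext (LinearMap.ext fun x => rfl)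
      inr_fst := hom_ext (LinearMap.ext fun x => rfl)
      inr_snd := hom_ext (LinearMap.ext fun x => rfl) }
  exact ⟨⟨⟨b, isBinaryBilimitOfTotal b (hom_ext (by
    apply LinearMap.ext
    rintro ⟨x, y⟩
    change ((x, 0) : M.carrier × N.carrier) + (0, y) = (x, y)
    simp))⟩⟩⟩

instance : HasFiniteProducts (RightComod k C) :=
  have : HasBinaryBiproducts (RightComod k C) := ⟨inferInstance⟩
  hasFiniteProducts_of_has_binary_and_terminal

section kernel

variable {M N : RightComod k C} (f : M ⟶ N)

lemma rTensor_inj {V W : Type u} [AddCommGroup V] [Module k V] [AddCommGroup W] [Module k W]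
    (D : Type u) [AddCommGroup D] [Module k D]
    {g : V →ₗ[k] W} (hg : Function.Injective g) : Function.Injective (g.rTensor D) :=
  Module.Flat.rTensor_preserves_injective_linearMap g hg

lemma coact_mem (x : (lin f).ker) :
    (M.coact ∘ₗ (lin f).ker.subtype) x ∈ LinearMap.range ((lin f).ker.subtype.rTensor C) := by
  have h := Module.Flat.rTensor_exact C (LinearMap.exact_subtype_ker_map (lin f))
  refine (h _).1 ?_
  rw [LinearMap.comp_apply, ← lin_comm_apply]
  simp

/-- The coaction on the kernel of a comodule homomorphism. -/
noncomputable def kerCoact : (lin f).ker →ₗ[k] (lin f).ker ⊗[k] C :=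
  LinearMap.codRestrictOfInjective (M.coact ∘ₗ (lin f).ker.subtype)
    ((lin f).ker.subtype.rTensor C) (rTensor_inj C (Submodule.subtype_injective _)) (coact_mem f)

lemma kerCoact_comp : (lin f).ker.subtype.rTensor C ∘ₗ kerCoact f =
    M.coact ∘ₗ (lin f).ker.subtype :=
  LinearMap.ext fun x => LinearMap.codRestrictOfInjective_comp_apply
    (M.coact ∘ₗ (lin f).ker.subtype) ((lin f).ker.subtype.rTensor C) _ _ x

/-- The kernel of a comodule homomorphism. -/
noncomputable def ker : RightComod k C where
  carrier := (lin f).ker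
  coact := kerCoact f
  counit_coact := LinearMap.ext fun x => Submodule.subtype_injective (lin f).ker
    ((nat_counit (kerCoact_comp f).symm x).symm.trans (M.counit_apply _))
  coassoc := LinearMap.ext fun x => rTensor_inj (C ⊗[k] C)
    (Submodule.subtype_injective (lin f).ker) ((nat_left (kerCoact_comp f).symm x).symm.trans
      ((M.coassoc_apply _).trans (nat_right (kerCoact_comp f).symm x)))

/-- The inclusion of the kernel. -/
noncomputable def kerι : ker f ⟶ M := homMk (lin f).ker.subtype (kerCoact_comp f).symm

lemma kerι_comp : kerι f ≫ f = 0 := hom_ext (LinearMap.ext fun x => x.2)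

/-- The universal property of the kernel. -/
noncomputable def kerLift {W : RightComod k C} (g : W ⟶ M) (hg : g ≫ f = 0) : W ⟶ ker f :=
  have h : ∀ x, lin g x ∈ (lin f).ker := fun x =>
    LinearMap.mem_ker.2 (LinearMap.congr_fun (congrArg lin hg) x)
  homMk ((lin g).codRestrict (lin f).ker h) (by
    apply LinearMap.ext
    intro x
    apply rTensor_inj C (Submodule.subtype_injective (lin f).ker)
    refine (LinearMap.congr_fun (kerCoact_comp f) _).trans ?_
    refine (lin_comm_apply g x).trans ?_
    exact LinearMap.congr_fun (LinearMap.rTensor_comp C (lin f).ker.subtype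
      ((lin g).codRestrict (lin f).ker h)) (W.coact x))

/-- The kernel is a categorical kernel. -/
noncomputable def kerIsLimit : IsLimit (KernelFork.ofι (kerι f) (kerι_comp f)) :=
  KernelFork.IsLimit.ofι _ _
    (fun g hg => kerLift f g hg)
    (fun _ _ => rfl)
    (fun _ _ _ hm => hom_ext (LinearMap.ext fun x => Subtype.ext
      (LinearMap.congr_fun (congrArg lin hm) x)))

instance : HasKernels (RightComod k C) := ⟨fun f => ⟨⟨_, kerIsLimit f⟩⟩⟩

instance : PreservesLimit (parallelPair f 0) (forget k C) := by
  refine preservesLimit_of_preserves_limit_cone (kerIsLimit f)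
    ((KernelFork.isLimitMapConeEquiv _ _).symm ?_)
  let S : ShortComplex (ModuleCat.{u} k) := ShortComplex.mk ((forget k C).map (kerι f))
    ((forget k C).map f) (by rw [← Functor.map_comp, kerι_comp, Functor.map_zero])
  have hS : S.Exact := by
    rw [ShortComplex.moduleCat_exact_iff]
    intro x hx
    exact ⟨⟨x, hx⟩, rfl⟩
  have : Mono S.f := (ModuleCat.mono_iff_injective _).2 (Submodule.subtype_injective _)
  exact hS.fIsKernel

end kernel

section cokernel

variable {M N : RightComod k C} (f : M ⟶ N)

/-- The coaction on the cokernel of a comodule homomorphism. -/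
noncomputable def cokerCoact : (N.carrier ⧸ (lin f).range) →ₗ[k] (N.carrier ⧸ (lin f).range) ⊗[k] C :=
  (lin f).range.liftQ ((lin f).range.mkQ.rTensor C ∘ₗ N.coact) (by
    rintro _ ⟨x, rfl⟩
    rw [LinearMap.mem_ker, LinearMap.comp_apply, lin_comm_apply, ← LinearMap.comp_apply,
      ← LinearMap.rTensor_comp, LinearMap.range_mkQ_comp]
    simp)

lemma cokerCoact_comp : cokerCoact f ∘ₗ (lin f).range.mkQ =
    (lin f).range.mkQ.rTensor C ∘ₗ N.coact := Submodule.liftQ_mkQ _ _ _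

/-- The cokernel of a comodule homomorphism. -/
noncomputable def coker : RightComod k C where
  carrier := N.carrier ⧸ (lin f).range
  coact := cokerCoact f
  counit_coact := Submodule.linearMap_qext _ (LinearMap.ext fun x =>
    (nat_counit (cokerCoact_comp f) x).trans (congrArg _ (N.counit_apply x)))
  coassoc := Submodule.linearMap_qext _ (LinearMap.ext fun x =>
    (nat_left (cokerCoact_comp f) x).trans
      ((congrArg _ (N.coassoc_apply x)).trans (nat_right (cokerCoact_comp f) x).symm))

/-- The projection to the cokernel. -/
noncomputable def cokerπ : N ⟶ coker f := homMk (lin f).range.mkQ (cokerCoact_comp f)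

lemma comp_cokerπ : f ≫ cokerπ f = 0 := hom_ext (LinearMap.range_mkQ_comp _)

/-- The universal property of the cokernel. -/
noncomputable def cokerDesc {W : RightComod k C} (g : N ⟶ W) (hg : f ≫ g = 0) : coker f ⟶ W :=
  have h : (lin f).range ≤ (lin g).ker := by
    rintro _ ⟨x, rfl⟩
    exact LinearMap.mem_ker.2 (LinearMap.congr_fun (congrArg lin hg) x)
  homMk ((lin f).range.liftQ (lin g) h) (by
    refine Submodule.linearMap_qext _ ?_
    change W.coact ∘ₗ ((lin f).range.liftQ (lin g) h ∘ₗ (lin f).range.mkQ) =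
      LinearMap.rTensor C ((lin f).range.liftQ (lin g) h) ∘ₗ (cokerCoact f ∘ₗ (lin f).range.mkQ)
    rw [cokerCoact_comp, ← LinearMap.comp_assoc N.coact, ← LinearMap.rTensor_comp,
      Submodule.liftQ_mkQ, lin_comm])

/-- The cokernel is a categorical cokernel. -/
noncomputable def cokerIsColimit : IsColimit (CokernelCofork.ofπ (cokerπ f) (comp_cokerπ f)) :=
  CokernelCofork.IsColimit.ofπ _ _
    (fun g hg => cokerDesc f g hg)
    (fun _ _ => hom_ext (Submodule.liftQ_mkQ _ _ _))
    (fun _ _ _ hm => hom_ext (by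
      apply Submodule.linearMap_qext
      exact (congrArg lin hm).trans (Submodule.liftQ_mkQ _ _ _).symm))

instance : HasCokernels (RightComod k C) := ⟨fun f => ⟨⟨_, cokerIsColimit f⟩⟩⟩

instance : PreservesColimit (parallelPair f 0) (forget k C) := by
  refine preservesColimit_of_preserves_colimit_cocone (cokerIsColimit f)
    ((CokernelCofork.isColimitMapCoconeEquiv _ _).symm ?_)
  let S : ShortComplex (ModuleCat.{u} k) := ShortComplex.mk ((forget k C).map f)
    ((forget k C).map (cokerπ f)) (by rw [← Functor.map_comp, comp_cokerπ, Functor.map_zero])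
  have hS : S.Exact := by
    rw [ShortComplex.moduleCat_exact_iff]
    intro x hx
    exact (Submodule.Quotient.mk_eq_zero _).1 hx
  have : Epi S.g := (ModuleCat.epi_iff_surjective _).2 (Submodule.mkQ_surjective _)
  exact hS.gIsCokernel

end cokernel

noncomputable instance : Abelian (RightComod k C) :=
  abelianOfConservative (forget k C) (fun _ => inferInstance) (fun _ => inferInstance)

instance : HasExt.{u + 1} (RightComod k C) := HasExt.standard _

end RightComod

/-- A left contramodule `P` over a (coassociative, counital) coalgebra `C` over a field `k`. The
contraassociativity axiom uses the identification `Hom(C ⊗ C, P) ≃ Hom(C, Hom(C, P))` which takes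
`g` to the map `c ↦ (c' ↦ g (c' ⊗ c))`. -/
structure LeftContra (k C : Type u) [Field k] [AddCommGroup C] [Module k C] [Coalgebra k C] where
  /-- the underlying vector space -/
  carrier : Type u
  [addCommGroup : AddCommGroup carrier]
  [module : Module k carrier]
  /-- the left contraaction `Hom(C, P) → P` -/
  contra : (C →ₗ[k] carrier) →ₗ[k] carrier
  contraunit : ∀ p : carrier, contra ((Coalgebra.counit (R := k) (A := C)).smulRight p) = p
  contraassoc : ∀ g : C ⊗[k] C →ₗ[k] carrier,
    contra (contra ∘ₗ (TensorProduct.curry g).flip) =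
      contra (g ∘ₗ Coalgebra.comul (R := k) (A := C))

namespace LeftContra

variable {k C : Type u} [Field k] [AddCommGroup C] [Module k C] [Coalgebra k C]

attribute [instance] addCommGroup module

/-- The space of contramodule homomorphisms: linear maps commuting with the contraactions. -/
def homs (P Q : LeftContra k C) : Submodule k (P.carrier →ₗ[k] Q.carrier) where
  carrier := {f | ∀ g : C →ₗ[k] P.carrier, f (P.contra g) = Q.contra (f ∘ₗ g)}
  add_mem' {f f'} hf hf' := by
    simp only [Set.mem_ofPred_eq] at *
    intro g
    rw [LinearMap.add_comp, map_add, ← hf, ← hf', LinearMap.add_apply]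
  zero_mem' := by simp
  smul_mem' c f hf := by
    simp only [Set.mem_ofPred_eq] at *
    intro g
    rw [LinearMap.smul_comp, map_smul, ← hf, LinearMap.smul_apply]

instance : Category (LeftContra k C) where
  Hom P Q := homs P Q
  id P := ⟨LinearMap.id, fun _ => rfl⟩
  comp {P Q R} f f' := ⟨f'.1 ∘ₗ f.1, fun g => by
    rw [LinearMap.comp_apply, f.2, f'.2, LinearMap.comp_assoc]⟩

/-- The linear map underlying a contramodule homomorphism. -/
def lin {P Q : LeftContra k C} (f : P ⟶ Q) : P.carrier →ₗ[k] Q.carrier := f.1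

/-- The contramodule homomorphism given by a linear map commuting with the contraactions. -/
def homMk {P Q : LeftContra k C} (f : P.carrier →ₗ[k] Q.carrier)
    (hf : ∀ g : C →ₗ[k] P.carrier, f (P.contra g) = Q.contra (f ∘ₗ g)) : P ⟶ Q := ⟨f, hf⟩

lemma lin_contra {P Q : LeftContra k C} (f : P ⟶ Q) (g : C →ₗ[k] P.carrier) :
    lin f (P.contra g) = Q.contra (lin f ∘ₗ g) := f.2 g

lemma hom_ext {P Q : LeftContra k C} {f g : P ⟶ Q} (h : lin f = lin g) : f = g := Subtype.ext h

@[simp] lemma lin_homMk {P Q : LeftContra k C} (f : P.carrier →ₗ[k] Q.carrier) (hf) :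
    lin (homMk (P := P) (Q := Q) f hf) = f := rfl

@[simp] lemma lin_id (P : LeftContra k C) : lin (𝟙 P) = LinearMap.id := rfl

@[simp] lemma lin_comp {P Q R : LeftContra k C} (f : P ⟶ Q) (g : Q ⟶ R) :
    lin (f ≫ g) = lin g ∘ₗ lin f := rfl

instance (P Q : LeftContra k C) : AddCommGroup (P ⟶ Q) :=
  inferInstanceAs (AddCommGroup (homs P Q))

instance (P Q : LeftContra k C) : Module k (P ⟶ Q) :=
  inferInstanceAs (Module k (homs P Q))

@[simp] lemma lin_add {P Q : LeftContra k C} (f g : P ⟶ Q) : lin (f + g) = lin f + lin g := rfl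
@[simp] lemma lin_zero {P Q : LeftContra k C} : lin (0 : P ⟶ Q) = 0 := rfl
@[simp] lemma lin_smul {P Q : LeftContra k C} (c : k) (f : P ⟶ Q) : lin (c • f) = c • lin f := rfl

instance : Preadditive (LeftContra k C) where
  add_comp _ _ _ f f' g := hom_ext (LinearMap.comp_add _ _ _)
  comp_add _ _ _ f g g' := hom_ext (LinearMap.add_comp _ _ _)

instance : Linear k (LeftContra k C) where
  smul_comp _ _ _ c f g := hom_ext (LinearMap.comp_smul _ _ _)
  comp_smul _ _ _ f c g := hom_ext (LinearMap.smul_comp _ _ _)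

variable (k C) in
/-- The forgetful functor from contramodules to vector spaces. -/
def forget : LeftContra k C ⥤ ModuleCat.{u} k where
  obj P := ModuleCat.of k P.carrier
  map f := ModuleCat.ofHom (lin f)

instance : (forget k C).Additive where
instance : (forget k C).Linear k where
instance : (forget k C).Faithful where
  map_injective h := hom_ext (congrArg ModuleCat.Hom.hom h)

instance : (forget k C).ReflectsIsomorphisms where
  reflects {P Q} f h := by
    let e := (asIso ((forget k C).map f)).toLinearEquiv
    have h1 : e.symm.toLinearMap ∘ₗ lin f = LinearMap.id :=
      LinearMap.ext fun x => e.symm_apply_apply x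
    have h2 : lin f ∘ₗ e.symm.toLinearMap = LinearMap.id :=
      LinearMap.ext fun x => e.apply_symm_apply x
    let g : Q.carrier →ₗ[k] P.carrier := e.symm.toLinearMap
    change g ∘ₗ lin f = LinearMap.id at h1
    change lin f ∘ₗ g = (LinearMap.id : Q.carrier →ₗ[k] Q.carrier) at h2
    refine ⟨homMk g (fun x => ?_), hom_ext h1, hom_ext h2⟩
    calc g (Q.contra x)
      _ = g (Q.contra (lin f ∘ₗ (g ∘ₗ x))) := by
          rw [← LinearMap.comp_assoc, h2, LinearMap.id_comp]
      _ = g (lin f (P.contra (g ∘ₗ x))) := by rw [lin_contra]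
      _ = P.contra (g ∘ₗ x) := LinearMap.congr_fun h1 _

/-- The zero contramodule. -/
def zero : LeftContra k C where
  carrier := PUnit
  contra := 0
  contraunit _ := rfl
  contraassoc _ := rfl

instance : HasZeroObject (LeftContra k C) :=
  ⟨zero, ⟨fun M => ⟨⟨⟨0⟩, fun f => hom_ext (LinearMap.ext fun x => by
      rw [show x = 0 from rfl, map_zero, map_zero])⟩⟩,
    fun M => ⟨⟨⟨0⟩, fun f => hom_ext (LinearMap.ext fun x => rfl)⟩⟩⟩⟩

/-- The direct product of two contramodules. -/
def prod (P Q : LeftContra k C) : LeftContra k C where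
  carrier := P.carrier × Q.carrier
  contra := LinearMap.prod (P.contra ∘ₗ LinearMap.compRight k (LinearMap.fst k P.carrier Q.carrier))
    (Q.contra ∘ₗ LinearMap.compRight k (LinearMap.snd k P.carrier Q.carrier))
  contraunit p := Prod.ext (P.contraunit p.1) (Q.contraunit p.2)
  contraassoc g := Prod.ext (P.contraassoc (LinearMap.fst k _ _ ∘ₗ g))
    (Q.contraassoc (LinearMap.snd k _ _ ∘ₗ g))

instance (P Q : LeftContra k C) : HasBinaryBiproduct P Q := by
  let b : BinaryBicone P Q :=
    { pt := prod P Q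
      fst := homMk (LinearMap.fst k _ _) (fun _ => rfl)
      snd := homMk (LinearMap.snd k _ _) (fun _ => rfl)
      inl := homMk (LinearMap.inl k _ _) (fun g => Prod.ext rfl (map_zero Q.contra).symm)
      inr := homMk (LinearMap.inr k _ _) (fun g => Prod.ext (map_zero P.contra).symm rfl)
      inl_fst := hom_ext (LinearMap.ext fun x => rfl)
      inl_snd := hom_ext (LinearMap.ext fun x => rfl)
      inr_fst := hom_ext (LinearMap.ext fun x => rfl)
      inr_snd := hom_ext (LinearMap.ext fun x => rfl) }
  exact ⟨⟨⟨b, isBinaryBilimitOfTotal b (hom_ext (by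
    apply LinearMap.ext
    rintro ⟨x, y⟩
    change ((x, 0) : P.carrier × Q.carrier) + (0, y) = (x, y)
    simp))⟩⟩⟩

instance : HasFiniteProducts (LeftContra k C) :=
  have : HasBinaryBiproducts (LeftContra k C) := ⟨inferInstance⟩
  hasFiniteProducts_of_has_binary_and_terminal

section kernel

variable {P Q : LeftContra k C} (f : P ⟶ Q)

/-- The kernel of a contramodule homomorphism. -/
def ker : LeftContra k C where
  carrier := (lin f).ker
  contra := LinearMap.codRestrict (lin f).ker
    (P.contra ∘ₗ LinearMap.compRight k (lin f).ker.subtype) (fun g => by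
      change lin f (P.contra ((lin f).ker.subtype ∘ₗ g)) = 0
      rw [lin_contra, ← LinearMap.comp_assoc, LinearMap.comp_ker_subtype, LinearMap.zero_comp,
        map_zero])
  contraunit p := Subtype.ext (P.contraunit p.1)
  contraassoc g := Subtype.ext (P.contraassoc ((lin f).ker.subtype ∘ₗ g))

/-- The inclusion of the kernel. -/
def kerι : ker f ⟶ P := homMk (lin f).ker.subtype (fun _ => rfl)

lemma kerι_comp : kerι f ≫ f = 0 := hom_ext (LinearMap.ext fun x => x.2)

/-- The universal property of the kernel. -/
def kerLift {W : LeftContra k C} (g : W ⟶ P) (hg : g ≫ f = 0) : W ⟶ ker f :=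
  have h : ∀ x, lin g x ∈ (lin f).ker := fun x =>
    LinearMap.mem_ker.2 (LinearMap.congr_fun (congrArg lin hg) x)
  homMk ((lin g).codRestrict (lin f).ker h) (fun x => Subtype.ext (lin_contra g x))

/-- The kernel is a categorical kernel. -/
def kerIsLimit : IsLimit (KernelFork.ofι (kerι f) (kerι_comp f)) :=
  KernelFork.IsLimit.ofι _ _
    (fun g hg => kerLift f g hg)
    (fun _ _ => rfl)
    (fun _ _ _ hm => hom_ext (LinearMap.ext fun x => Subtype.ext
      (LinearMap.congr_fun (congrArg lin hm) x)))

instance : HasKernels (LeftContra k C) := ⟨fun f => ⟨⟨_, kerIsLimit f⟩⟩⟩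

instance : PreservesLimit (parallelPair f 0) (forget k C) := by
  refine preservesLimit_of_preserves_limit_cone (kerIsLimit f)
    ((KernelFork.isLimitMapConeEquiv _ _).symm ?_)
  let S : ShortComplex (ModuleCat.{u} k) := ShortComplex.mk ((forget k C).map (kerι f))
    ((forget k C).map f) (by rw [← Functor.map_comp, kerι_comp, Functor.map_zero])
  have hS : S.Exact := by
    rw [ShortComplex.moduleCat_exact_iff]
    intro x hx
    exact ⟨⟨x, hx⟩, rfl⟩
  have : Mono S.f := (ModuleCat.mono_iff_injective _).2 (Submodule.subtype_injective _)
  exact hS.fIsKernel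

end kernel

section cokernel

variable {P Q : LeftContra k C} (f : P ⟶ Q)

/-- A linear section of the projection to the cokernel. -/
noncomputable def cokerSection : (Q.carrier ⧸ (lin f).range) →ₗ[k] Q.carrier :=
  Classical.choose ((lin f).range.mkQ.exists_rightInverse_of_surjective (Submodule.range_mkQ _))

lemma mkQ_cokerSection : (lin f).range.mkQ ∘ₗ cokerSection f = LinearMap.id :=
  Classical.choose_spec
    ((lin f).range.mkQ.exists_rightInverse_of_surjective (Submodule.range_mkQ _))

lemma exists_mkQ_comp {V : Type u} [AddCommGroup V] [Module k V]
    (g : V →ₗ[k] Q.carrier ⧸ (lin f).range) :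
    ∃ g' : V →ₗ[k] Q.carrier, (lin f).range.mkQ ∘ₗ g' = g :=
  ⟨cokerSection f ∘ₗ g, by rw [← LinearMap.comp_assoc, mkQ_cokerSection, LinearMap.id_comp]⟩

/-- The contraaction on the cokernel of a contramodule homomorphism. It does not depend on the
choice of the section, see `cokerContra_mkQ`. -/
noncomputable def cokerContra :
    (C →ₗ[k] Q.carrier ⧸ (lin f).range) →ₗ[k] Q.carrier ⧸ (lin f).range :=
  (lin f).range.mkQ ∘ₗ Q.contra ∘ₗ LinearMap.compRight k (cokerSection f)

lemma cokerContra_mkQ (g : C →ₗ[k] Q.carrier) :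
    cokerContra f ((lin f).range.mkQ ∘ₗ g) = (lin f).range.mkQ (Q.contra g) := by
  change (lin f).range.mkQ (Q.contra (cokerSection f ∘ₗ (lin f).range.mkQ ∘ₗ g)) = _
  rw [← sub_eq_zero, ← map_sub, ← map_sub, ← LinearMap.mem_ker, Submodule.ker_mkQ]
  set d := cokerSection f ∘ₗ (lin f).range.mkQ ∘ₗ g - g with hd
  have h0 : (lin f).range.mkQ ∘ₗ d = 0 := by
    rw [hd, LinearMap.comp_sub, ← LinearMap.comp_assoc, mkQ_cokerSection, LinearMap.id_comp,
      sub_self]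
  have h1 : ∀ c, d c ∈ (lin f).range := fun c => by
    rw [← Submodule.ker_mkQ (lin f).range, LinearMap.mem_ker]
    exact LinearMap.congr_fun h0 c
  obtain ⟨s, hs⟩ := (lin f).rangeRestrict.exists_rightInverse_of_surjective
    (lin f).range_rangeRestrict
  refine ⟨P.contra (s ∘ₗ d.codRestrict _ h1), ?_⟩
  rw [lin_contra]
  congr 1
  apply LinearMap.ext
  intro c
  exact congrArg Subtype.val (LinearMap.congr_fun hs ⟨d c, h1 c⟩)

/-- The cokernel of a contramodule homomorphism. -/
noncomputable def coker : LeftContra k C where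
  carrier := Q.carrier ⧸ (lin f).range
  contra := cokerContra f
  contraunit p := by
    obtain ⟨p, rfl⟩ := Submodule.mkQ_surjective _ p
    exact (cokerContra_mkQ f _).trans (congrArg _ (Q.contraunit p))
  contraassoc g := by
    obtain ⟨g, rfl⟩ := exists_mkQ_comp f g
    have h : cokerContra f ∘ₗ (TensorProduct.curry ((lin f).range.mkQ ∘ₗ g)).flip =
        (lin f).range.mkQ ∘ₗ Q.contra ∘ₗ (TensorProduct.curry g).flip :=
      LinearMap.ext fun c => cokerContra_mkQ f ((TensorProduct.curry g).flip c)
    rw [h, cokerContra_mkQ, LinearMap.comp_assoc, cokerContra_mkQ, Q.contraassoc]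

/-- The projection to the cokernel. -/
noncomputable def cokerπ : Q ⟶ coker f :=
  homMk (lin f).range.mkQ (fun g => (cokerContra_mkQ f g).symm)

lemma comp_cokerπ : f ≫ cokerπ f = 0 := hom_ext (LinearMap.range_mkQ_comp _)

/-- The universal property of the cokernel. -/
noncomputable def cokerDesc {W : LeftContra k C} (g : Q ⟶ W) (hg : f ≫ g = 0) : coker f ⟶ W :=
  have h : (lin f).range ≤ (lin g).ker := by
    rintro _ ⟨x, rfl⟩
    exact LinearMap.mem_ker.2 (LinearMap.congr_fun (congrArg lin hg) x)
  homMk ((lin f).range.liftQ (lin g) h) (fun x => by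
    obtain ⟨x, rfl⟩ := exists_mkQ_comp f x
    refine (congrArg _ (cokerContra_mkQ f x)).trans ?_
    exact lin_contra g x)

/-- The cokernel is a categorical cokernel. -/
noncomputable def cokerIsColimit : IsColimit (CokernelCofork.ofπ (cokerπ f) (comp_cokerπ f)) :=
  CokernelCofork.IsColimit.ofπ _ _
    (fun g hg => cokerDesc f g hg)
    (fun _ _ => hom_ext (Submodule.liftQ_mkQ _ _ _))
    (fun _ _ _ hm => hom_ext (by
      apply Submodule.linearMap_qext
      exact (congrArg lin hm).trans (Submodule.liftQ_mkQ _ _ _).symm))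

instance : HasCokernels (LeftContra k C) := ⟨fun f => ⟨⟨_, cokerIsColimit f⟩⟩⟩

instance : PreservesColimit (parallelPair f 0) (forget k C) := by
  refine preservesColimit_of_preserves_colimit_cocone (cokerIsColimit f)
    ((CokernelCofork.isColimitMapCoconeEquiv _ _).symm ?_)
  let S : ShortComplex (ModuleCat.{u} k) := ShortComplex.mk ((forget k C).map f)
    ((forget k C).map (cokerπ f)) (by rw [← Functor.map_comp, comp_cokerπ, Functor.map_zero])
  have hS : S.Exact := by
    rw [ShortComplex.moduleCat_exact_iff]
    intro x hx
    exact (Submodule.Quotient.mk_eq_zero _).1 hx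
  have : Epi S.g := (ModuleCat.epi_iff_surjective _).2 (Submodule.mkQ_surjective _)
  exact hS.gIsCokernel

end cokernel

noncomputable instance : Abelian (LeftContra k C) :=
  abelianOfConservative (forget k C) (fun _ => inferInstance) (fun _ => inferInstance)

instance : HasExt.{u + 1} (LeftContra k C) := HasExt.standard _

end LeftContra

section ContravariantExt

open Abelian Opposite

variable {A : Type*} [Category A] [Abelian A] {B : Type*} [Category B] [Abelian B]

/-- Let `K` be a complex concentrated in nonpositive degrees and `s : K ⟶ X` a quasi-isomorphism
onto an object placed in degree zero. Then `s` is an epimorphism in degree zero. -/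
lemma epi_f_zero_of_quasiIsoAt {K : CochainComplex A ℤ} {X : A}
    (s : K ⟶ (HomologicalComplex.single A (ComplexShape.up ℤ) 0).obj X) [K.IsStrictlyLE 0]
    [QuasiIsoAt s 0] : Epi (s.f 0) := by
  let e := K.iCyclesIso 0 (0 + 1) (by simp)
    ((K.isZero_of_isStrictlyLE 0 (0 + 1) (by simp)).eq_of_tgt _ _)
  let α := e.inv ≫ K.homologyπ 0 ≫ HomologicalComplex.homologyMap s 0 ≫
    (HomologicalComplex.singleObjHomologySelfIso _ _ _).hom
  have : s.f 0 = α ≫ (HomologicalComplex.singleObjXSelf (ComplexShape.up ℤ) 0 X).inv := by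
    rw [← cancel_epi e.hom]
    dsimp only [α]
    rw [Category.assoc, Category.assoc, Category.assoc, Iso.hom_inv_id_assoc,
      HomologicalComplex.homologyπ_naturality_assoc,
      HomologicalComplex.homologyπ_singleObjHomologySelfIso_hom_assoc,
      ← HomologicalComplex.singleObjCyclesSelfIso_inv_iCycles, Iso.hom_inv_id_assoc,
      HomologicalComplex.cyclesMap_i]
    rfl
  rw [this]
  infer_instance

/-- The pullback of a short exact sequence along `f` and a short exact sequence with the same
third term are dominated by a third short exact sequence. -/
lemma exists_dominating {Z M X Z' M' X' : A} {i : Z ⟶ M} {p : M ⟶ X} {w : i ≫ p = 0}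
    {i' : Z' ⟶ M'} {p' : M' ⟶ X'} {w' : i' ≫ p' = 0}
    (hS : (ShortComplex.mk i p w).ShortExact) (hS' : (ShortComplex.mk i' p' w').ShortExact)
    (f : X' ⟶ X) :
    ∃ (Z'' M'' : A) (j : Z'' ⟶ M'') (q : M'' ⟶ X') (v : j ≫ q = 0)
      (_ : (ShortComplex.mk j q v).ShortExact) (a : Z'' ⟶ Z) (b : M'' ⟶ M) (a' : Z'' ⟶ Z')
      (b' : M'' ⟶ M'), a ≫ i = j ≫ b ∧ b ≫ p = q ≫ f ∧ a' ≫ i' = j ≫ b' ∧ b' ≫ p' = q := by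
  have := hS.epi_g
  have := hS'.epi_g
  have := hS.mono_f
  have := hS'.mono_f
  dsimp at *
  let q := pullback.fst (p' ≫ f) p ≫ p'
  refine ⟨_, _, kernel.ι q, q, kernel.condition q, { exact := ShortComplex.exact_kernel q },
    hS.exact.lift (kernel.ι q ≫ pullback.snd _ _) ?_, pullback.snd _ _,
    hS'.exact.lift (kernel.ι q ≫ pullback.fst _ _) ?_, pullback.fst _ _, ?_, ?_, ?_, rfl⟩
  · simpa [q, ← pullback.condition] using kernel.condition_assoc q f
  · simp [q]
  · exact hS.exact.lift_f _ _
  · simp [q, pullback.condition]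
  · exact hS'.exact.lift_f _ _

variable (D : Aᵒᵖ ⥤ B) [D.Additive] [PreservesFiniteLimits D] [PreservesFiniteColimits D]

/-- The image of a short exact sequence `0 → Z → M → X → 0` under a contravariant exact functor
is a short exact sequence `0 → D X → D M → D Z → 0`. -/
lemma shortExact_contra {Z M X : A} {i : Z ⟶ M} {p : M ⟶ X} {w : i ≫ p = 0}
    (hS : (ShortComplex.mk i p w).ShortExact) :
    (ShortComplex.mk (D.map p.op) (D.map i.op)
      (by rw [← D.map_comp, ← op_comp, w, op_zero, D.map_zero])).ShortExact :=
  hS.op.map_of_exact D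

variable [HasExt A] [HasExt B]

open DerivedCategory in
/-- Every Ext class of positive degree is killed by the pullback along some epimorphism. -/
lemma exists_epi_comp_eq_zero {X Y : A} {n : ℕ} (α : Ext X Y (n + 1)) :
    ∃ (M : A) (p : M ⟶ X) (_ : Epi p), (Ext.mk₀ p).comp α (zero_add _) = 0 := by
  let := HasDerivedCategory.standard A
  let L := (CochainComplex.singleFunctor A (-((n : ℤ) + 1))).obj Y
  let u := ((singleFunctors A).shiftIso ((n : ℤ) + 1) (-(n + 1)) 0 (by lia)).hom.app Y
  let φ : Q.obj ((CochainComplex.singleFunctor A 0).obj X) ⟶ Q.obj L := α.hom ≫ u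
  obtain ⟨K, _, s, hs, g, hφ⟩ := right_fac_of_isStrictlyLE φ 0
  have hs' : QuasiIso s := by rwa [isIso_Q_map_iff_quasiIso] at hs
  let ι : (CochainComplex.singleFunctor A 0).obj (K.X 0) ⟶ K :=
    HomologicalComplex.mkHomFromSingle (𝟙 (K.X 0)) (by
      rintro _ rfl
      apply (K.isZero_of_isStrictlyLE 0 (0 + 1) (by simp)).eq_of_tgt)
  obtain ⟨p, hp⟩ := (CochainComplex.singleFunctor A 0).map_surjective (ι ≫ s)
  have hι : ι ≫ g = 0 := by
    apply HomologicalComplex.from_single_hom_ext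
    apply (L.isZero_of_isStrictlyLE (-((n : ℤ) + 1)) 0 (by lia)).eq_of_tgt
  refine ⟨K.X 0, p, ?_, ?_⟩
  · let t : K ⟶ (HomologicalComplex.single A (ComplexShape.up ℤ) 0).obj X := s
    have ht : QuasiIso t := hs'
    have h1 := epi_f_zero_of_quasiIsoAt t
    have h2 : p = t.f 0 ≫ (HomologicalComplex.singleObjXSelf (ComplexShape.up ℤ) 0 X).hom := by
      have h3 : ((HomologicalComplex.single A (ComplexShape.up ℤ) 0).map p).f 0 =
          (ι ≫ s).f 0 := congrArg (fun f => HomologicalComplex.Hom.f f 0) hp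
      have h4 : (ι ≫ s).f 0 =
          (HomologicalComplex.singleObjXSelf (ComplexShape.up ℤ) 0 (K.X 0)).hom ≫ t.f 0 := by
        rw [HomologicalComplex.comp_f]
        exact congrArg (fun f => f ≫ t.f 0)
          ((HomologicalComplex.mkHomFromSingle_f _ _).trans (Category.comp_id _))
      have h5 := (HomologicalComplex.single_map_f_self (ComplexShape.up ℤ) 0 p).symm.trans
        (h3.trans h4)
      rw [cancel_epi] at h5
      rw [← h5, Category.assoc, Iso.inv_hom_id, Category.comp_id]
    rw [h2]
    exact epi_comp _ _
  · apply Ext.homEquiv.injective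
    simp only [Ext.zero_hom]
    change ((Ext.mk₀ p).comp α _).hom = 0
    rw [Ext.comp_hom, Ext.mk₀_hom, ShiftedHom.mk₀_comp, ← cancel_mono u, Category.assoc]
    change Q.map ((CochainComplex.singleFunctor A 0).map p) ≫ φ = _
    rw [hp, hφ, Functor.map_comp, Category.assoc, IsIso.hom_inv_id_assoc, ← Functor.map_comp, hι]
    simp
    rfl

/-- Every Ext class of degree `n + 1` is the Yoneda product of the class of a short exact sequence
with an Ext class of degree `n`. -/
lemma exists_extClass_comp {X Y : A} {n : ℕ} (α : Ext X Y (n + 1)) :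
    ∃ (Z M : A) (i : Z ⟶ M) (p : M ⟶ X) (w : i ≫ p = 0)
      (hS : (ShortComplex.mk i p w).ShortExact) (β : Ext Z Y n),
      hS.extClass.comp β (add_comm 1 n) = α := by
  obtain ⟨M, p, hp, h⟩ := exists_epi_comp_eq_zero α
  have hS : (ShortComplex.mk (kernel.ι p) p (kernel.condition p)).ShortExact :=
    { exact := ShortComplex.exact_kernel p }
  obtain ⟨β, hβ⟩ := Ext.contravariant_sequence_exact₃ hS Y α h (add_comm 1 n)
  exact ⟨_, M, _, p, _, hS, β, hβ⟩

/-- The maps `Ext^n(X, Y) → Ext^n(D Y, D X)`, natural in `X`, for a fixed number `n`. -/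
structure ContraExtMaps (n : ℕ) where
  /-- the maps -/
  map (X Y : A) : Ext X Y n →+ Ext (D.obj (op Y)) (D.obj (op X)) n
  /-- naturality -/
  naturality {X' X Y : A} (f : X' ⟶ X) (α : Ext X Y n) :
    map X' Y ((Ext.mk₀ f).comp α (zero_add n)) =
      (map X Y α).comp (Ext.mk₀ (D.map f.op)) (add_zero n)

namespace ContraExtMaps

variable {D} {n : ℕ} (T : ContraExtMaps D n)

lemma comp_eq_zero {Z M X Y : A} {i : Z ⟶ M} {p : M ⟶ X} {w : i ≫ p = 0}
    (hS : (ShortComplex.mk i p w).ShortExact) (β : Ext Z Y n)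
    (h : hS.extClass.comp β (add_comm 1 n) = 0) :
    (T.map _ _ β).comp (shortExact_contra D hS).extClass (rfl : n + 1 = n + 1) = 0 := by
  obtain ⟨γ, rfl⟩ := Ext.contravariant_sequence_exact₁ hS Y β (add_comm 1 n) h
  dsimp at γ ⊢
  rw [T.naturality, Ext.comp_assoc_of_second_deg_zero]
  have := (shortExact_contra D hS).comp_extClass
  dsimp at this
  rw [this, Ext.comp_zero]

lemma comp_naturality {Z M X Z' M' X' Y : A} {i : Z ⟶ M} {p : M ⟶ X} {w : i ≫ p = 0}
    {i' : Z' ⟶ M'} {p' : M' ⟶ X'} {w' : i' ≫ p' = 0}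
    (hS : (ShortComplex.mk i p w).ShortExact) (hS' : (ShortComplex.mk i' p' w').ShortExact)
    (a : Z' ⟶ Z) (b : M' ⟶ M) (f : X' ⟶ X) (h₁ : a ≫ i = i' ≫ b) (h₂ : b ≫ p = p' ≫ f)
    (β : Ext Z Y n) :
    (T.map _ _ ((Ext.mk₀ a).comp β (zero_add n))).comp (shortExact_contra D hS').extClass
        (rfl : n + 1 = n + 1) =
      ((T.map _ _ β).comp (shortExact_contra D hS).extClass (rfl : n + 1 = n + 1)).comp
        (Ext.mk₀ (D.map f.op)) (add_zero _) := by
  let φ : ShortComplex.mk (D.map p.op) (D.map i.op)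
      (by rw [← D.map_comp, ← op_comp, w, op_zero, D.map_zero]) ⟶
      ShortComplex.mk (D.map p'.op) (D.map i'.op)
      (by rw [← D.map_comp, ← op_comp, w', op_zero, D.map_zero]) :=
    { τ₁ := D.map f.op
      τ₂ := D.map b.op
      τ₃ := D.map a.op
      comm₁₂ := by dsimp; rw [← D.map_comp, ← D.map_comp, ← op_comp, ← op_comp, h₂]
      comm₂₃ := by dsimp; rw [← D.map_comp, ← D.map_comp, ← op_comp, ← op_comp, h₁] }
  have h := ShortComplex.ShortExact.extClass_naturality (shortExact_contra D hS)
    (shortExact_contra D hS') φ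
  dsimp [φ] at h
  rw [T.naturality, Ext.comp_assoc_of_second_deg_zero, ← h, Ext.comp_assoc_of_third_deg_zero]

lemma extClass_comp_naturality {Z M X Z' M' X' Y : A} {i : Z ⟶ M} {p : M ⟶ X} {w : i ≫ p = 0}
    {i' : Z' ⟶ M'} {p' : M' ⟶ X'} {w' : i' ≫ p' = 0}
    (hS : (ShortComplex.mk i p w).ShortExact) (hS' : (ShortComplex.mk i' p' w').ShortExact)
    (a : Z' ⟶ Z) (b : M' ⟶ M) (f : X' ⟶ X) (h₁ : a ≫ i = i' ≫ b) (h₂ : b ≫ p = p' ≫ f)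
    (β : Ext Z Y n) :
    hS'.extClass.comp ((Ext.mk₀ a).comp β (zero_add n)) (add_comm 1 n) =
      (Ext.mk₀ f).comp (hS.extClass.comp β (add_comm 1 n)) (zero_add _) := by
  let φ : ShortComplex.mk i' p' w' ⟶ ShortComplex.mk i p w :=
    { τ₁ := a, τ₂ := b, τ₃ := f }
  have h := ShortComplex.ShortExact.extClass_naturality hS' hS φ
  dsimp [φ] at h
  rw [← Ext.comp_assoc_of_second_deg_zero, h, Ext.comp_assoc (h₁₂ := zero_add 1)
    (h₂₃ := add_comm 1 n)]
  lia

lemma comp_eq_of_eq {Z M X Z' M' X' Y : A} {i : Z ⟶ M} {p : M ⟶ X} {w : i ≫ p = 0}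
    {i' : Z' ⟶ M'} {p' : M' ⟶ X'} {w' : i' ≫ p' = 0}
    (hS : (ShortComplex.mk i p w).ShortExact) (hS' : (ShortComplex.mk i' p' w').ShortExact)
    (f : X' ⟶ X) (β : Ext Z Y n) (β' : Ext Z' Y n)
    (h : (Ext.mk₀ f).comp (hS.extClass.comp β (add_comm 1 n)) (zero_add _) =
      hS'.extClass.comp β' (add_comm 1 n)) :
    ((T.map _ _ β).comp (shortExact_contra D hS).extClass (rfl : n + 1 = n + 1)).comp
        (Ext.mk₀ (D.map f.op)) (add_zero _) =
      (T.map _ _ β').comp (shortExact_contra D hS').extClass (rfl : n + 1 = n + 1) := by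
  obtain ⟨Z'', M'', j, q, v, hS'', a, b, a', b', e₁, e₂, e₃, e₄⟩ := exists_dominating hS hS' f
  have e₄' : b' ≫ p' = q ≫ 𝟙 X' := by rw [e₄, Category.comp_id]
  have h0 := T.comp_eq_zero hS'' ((Ext.mk₀ a).comp β (zero_add n) -
    (Ext.mk₀ a').comp β' (zero_add n)) (by
      rw [sub_eq_add_neg, Ext.comp_add, Ext.comp_neg, extClass_comp_naturality hS hS'' a b f e₁ e₂,
        extClass_comp_naturality hS' hS'' a' b' (𝟙 X') e₃ e₄', h, Ext.mk₀_id_comp,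
        add_neg_cancel])
  rw [map_sub, sub_eq_add_neg, Ext.add_comp, Ext.neg_comp, ← sub_eq_add_neg, sub_eq_zero, T.comp_naturality hS hS'' a b f e₁ e₂,
    T.comp_naturality hS' hS'' a' b' (𝟙 X') e₃ e₄'] at h0
  rw [h0]
  simp

variable (D) in
/-- In degree zero, the maps are given by the action of the functor on morphisms. -/
noncomputable def zero : ContraExtMaps D 0 where
  map X Y := AddMonoidHom.mk' (fun α => Ext.mk₀ (D.map (Ext.addEquiv₀ α).op)) (fun α β => by
    rw [map_add, op_add, D.map_add, Ext.mk₀_add])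
  naturality f α := by
    obtain ⟨g, rfl⟩ := Ext.addEquiv₀.symm.surjective α
    have h : (Ext.mk₀ f).comp (Ext.addEquiv₀.symm g) (zero_add 0) =
        Ext.addEquiv₀.symm (f ≫ g) := by simp
    simp only [AddMonoidHom.mk'_apply]
    rw [h, AddEquiv.apply_symm_apply, AddEquiv.apply_symm_apply, Ext.mk₀_comp_mk₀,
      ← D.map_comp, ← op_comp]

/-- The value on an Ext class `α` of degree `n + 1`: if `α` is the Yoneda product of a short exact
sequence `0 → Z → M → X → 0` and `β`, then this is the Yoneda product of the value on `β` and
`0 → D X → D M → D Z → 0`. It does not depend on the presentation, see `succMap_eq`. -/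
noncomputable def succMap {X Y : A} (α : Ext X Y (n + 1)) :
    Ext (D.obj (op Y)) (D.obj (op X)) (n + 1) :=
  have h := exists_extClass_comp α
  have h' := h.choose_spec.choose_spec.choose_spec.choose_spec.choose_spec
  (T.map _ _ h'.choose_spec.choose).comp (shortExact_contra D h'.choose).extClass rfl

lemma exists_succMap_eq {X Y : A} (α : Ext X Y (n + 1)) :
    ∃ (Z M : A) (i : Z ⟶ M) (p : M ⟶ X) (w : i ≫ p = 0)
      (hS : (ShortComplex.mk i p w).ShortExact) (β : Ext Z Y n),
      hS.extClass.comp β (add_comm 1 n) = α ∧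
      T.succMap α = (T.map _ _ β).comp (shortExact_contra D hS).extClass rfl := by
  have h := exists_extClass_comp α
  have h' := h.choose_spec.choose_spec.choose_spec.choose_spec.choose_spec
  exact ⟨_, _, _, _, _, h'.choose, h'.choose_spec.choose, h'.choose_spec.choose_spec, rfl⟩

lemma succMap_eq {Z M X Y : A} {i : Z ⟶ M} {p : M ⟶ X} {w : i ≫ p = 0}
    (hS : (ShortComplex.mk i p w).ShortExact) (β : Ext Z Y n) :
    T.succMap (hS.extClass.comp β (add_comm 1 n)) =
      (T.map _ _ β).comp (shortExact_contra D hS).extClass rfl := by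
  obtain ⟨Z', M', i', p', w', hS', β', h, e⟩ :=
    T.exists_succMap_eq (hS.extClass.comp β (add_comm 1 n))
  rw [e, ← T.comp_eq_of_eq hS hS' (𝟙 X) β β' (by rw [Ext.mk₀_id_comp, h])]
  simp

lemma succMap_add {X Y : A} (α β : Ext X Y (n + 1)) :
    T.succMap (α + β) = T.succMap α + T.succMap β := by
  obtain ⟨Z, M, i, p, w, hS, α, rfl⟩ := exists_extClass_comp α
  obtain ⟨Z', M', i', p', w', hS', β, rfl⟩ := exists_extClass_comp β
  obtain ⟨Z'', M'', j, q, v, hS'', a, b, a', b', e₁, e₂, e₃, e₄⟩ := exists_dominating hS hS' (𝟙 X)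
  have e₄' : b' ≫ p' = q ≫ 𝟙 X := by rw [e₄, Category.comp_id]
  have h₁ := extClass_comp_naturality hS hS'' a b (𝟙 X) e₁ e₂ α
  have h₂ := extClass_comp_naturality hS' hS'' a' b' (𝟙 X) e₃ e₄' β
  rw [Ext.mk₀_id_comp] at h₁ h₂
  rw [← h₁, ← h₂, ← Ext.comp_add, succMap_eq, succMap_eq, succMap_eq, map_add, Ext.add_comp]

lemma succMap_naturality {X' X Y : A} (f : X' ⟶ X) (α : Ext X Y (n + 1)) :
    T.succMap ((Ext.mk₀ f).comp α (zero_add (n + 1))) =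
      (T.succMap α).comp (Ext.mk₀ (D.map f.op)) (add_zero _) := by
  obtain ⟨Z, M, i, p, w, hS, β, h, e⟩ := T.exists_succMap_eq α
  obtain ⟨Z', M', i', p', w', hS', β', h', e'⟩ :=
    T.exists_succMap_eq ((Ext.mk₀ f).comp α (zero_add (n + 1)))
  rw [e, e', T.comp_eq_of_eq hS hS' f β β' (by rw [h, h'])]

/-- The passage from degree `n` to degree `n + 1`. -/
noncomputable def succ : ContraExtMaps D (n + 1) where
  map _ _ := AddMonoidHom.mk' T.succMap T.succMap_add
  naturality := T.succMap_naturality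

variable (D) in
/-- The maps induced by a contravariant exact functor in all degrees. -/
noncomputable def all : ∀ n : ℕ, ContraExtMaps D n
  | 0 => zero D
  | n + 1 => (all n).succ

end ContraExtMaps

/-- The map `Ext^n(X, Y) → Ext^n(D Y, D X)` induced by a contravariant exact functor `D`. It takes
the class of a Yoneda extension to the class of the Yoneda extension obtained by applying `D`, see
`contraExt_mk₀` and `contraExt_extClass_comp` (which determine this map in view of
`exists_extClass_comp`). -/
noncomputable def contraExt (X Y : A) (n : ℕ) :
    Ext X Y n →+ Ext (D.obj (op Y)) (D.obj (op X)) n := (ContraExtMaps.all D n).map X Y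

lemma contraExt_mk₀ {X Y : A} (f : X ⟶ Y) :
    contraExt D X Y 0 (Ext.mk₀ f) = Ext.mk₀ (D.map f.op) := by
  change Ext.mk₀ (D.map (Ext.addEquiv₀ (Ext.mk₀ f)).op) = _
  rw [← Ext.addEquiv₀_symm_apply f, AddEquiv.apply_symm_apply]

lemma contraExt_extClass_comp {Z M X Y : A} {i : Z ⟶ M} {p : M ⟶ X} {w : i ≫ p = 0}
    (hS : (ShortComplex.mk i p w).ShortExact) {n : ℕ} (β : Ext Z Y n) :
    contraExt D X Y (n + 1) (hS.extClass.comp β (add_comm 1 n)) =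
      (contraExt D Z Y n β).comp (shortExact_contra D hS).extClass rfl :=
  (ContraExtMaps.all D n).succMap_eq hS β

end ContravariantExt

section Functors

variable {k : Type u} [Field k]

lemma moduleCat_shortExact_iff (S : ShortComplex (ModuleCat.{u} k)) :
    S.ShortExact ↔ Function.Injective S.f.hom ∧ Function.Exact S.f.hom S.g.hom ∧
      Function.Surjective S.g.hom :=
  ⟨fun h => ⟨h.moduleCat_injective_f, (ShortComplex.ShortExact.moduleCat_exact_iff_function_exact S).1 h.exact,
    h.moduleCat_surjective_g⟩,
   fun h => ShortComplex.ShortExact.mk' ((ShortComplex.ShortExact.moduleCat_exact_iff_function_exact S).2 h.2.1)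
    ((ModuleCat.mono_iff_injective _).2 h.1) ((ModuleCat.epi_iff_surjective _).2 h.2.2)⟩

lemma exact_of_map_shortExact {A B : Type*} [Category A] [Category B] [Abelian A] [Abelian B]
    (F : A ⥤ B) [F.Additive] (h : ∀ S : ShortComplex A, S.ShortExact → (S.map F).ShortExact) :
    PreservesFiniteLimits F ∧ PreservesFiniteColimits F :=
  (F.exact_tfae.out 0 3).1 h

lemma shortExact_of_map {A B : Type*} [Category A] [Category B] [Abelian A] [Abelian B]
    (F : A ⥤ B) [F.Additive] [F.PreservesHomology] [F.Faithful] (S : ShortComplex A)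
    (h : (S.map F).ShortExact) : S.ShortExact :=
  { exact := (ShortComplex.exact_map_iff_of_faithful S F).1 h.exact
    mono_f := F.mono_of_mono_map h.mono_f
    epi_g := F.epi_of_epi_map h.epi_g }

variable {C : Type u} [AddCommGroup C] [Module k C] [Coalgebra k C]

instance : (RightComod.forget k C).PreservesHomology where
instance : (LeftContra.forget k C).PreservesHomology where

lemma RightComod.shortExact_iff (S : ShortComplex (RightComod k C)) :
    S.ShortExact ↔ Function.Injective (lin S.f) ∧ Function.Exact (lin S.f) (lin S.g) ∧
      Function.Surjective (lin S.g) := by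
  have e := ((RightComod.forget k C).exact_tfae.out 2 3 :
    (RightComod.forget k C).PreservesHomology ↔ _).1 inferInstance
  have := e.1
  have := e.2
  refine Iff.trans ⟨fun h => h.map_of_exact _, shortExact_of_map (RightComod.forget k C) S⟩
    (moduleCat_shortExact_iff (S.map (RightComod.forget k C)))

lemma LeftContra.shortExact_iff (S : ShortComplex (LeftContra k C)) :
    S.ShortExact ↔ Function.Injective (lin S.f) ∧ Function.Exact (lin S.f) (lin S.g) ∧
      Function.Surjective (lin S.g) := by
  have e := ((LeftContra.forget k C).exact_tfae.out 2 3 :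
    (LeftContra.forget k C).PreservesHomology ↔ _).1 inferInstance
  have := e.1
  have := e.2
  refine Iff.trans ⟨fun h => h.map_of_exact _, shortExact_of_map (LeftContra.forget k C) S⟩
    (moduleCat_shortExact_iff (S.map (LeftContra.forget k C)))

/-- The contraaction on the dual vector space `N* = Hom(N, k)` of a right comodule: the composition
`Hom(C, Hom(N, k)) ≃ Hom(N ⊗ C, k) → Hom(N, k)`, where the second map is the composition with the
coaction of `N`. -/
def RightComod.dualContra (N : RightComod k C) :
    (C →ₗ[k] Module.Dual k N.carrier) →ₗ[k] Module.Dual k N.carrier where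
  toFun g := TensorProduct.lift g.flip ∘ₗ N.coact
  map_add' g g' := by
    rw [← LinearMap.add_comp]
    congr 1
    ext
    simp
  map_smul' c g := by
    rw [RingHom.id_apply, ← LinearMap.smul_comp]
    congr 1
    ext
    simp

lemma RightComod.dualContra_apply (N : RightComod k C) (g : C →ₗ[k] Module.Dual k N.carrier)
    (n : N.carrier) : N.dualContra g n = TensorProduct.lift g.flip (N.coact n) := rfl

/-- The left contramodule `N* = Hom(N, k)` dual to a right comodule `N`. -/
def RightComod.dual (N : RightComod k C) : LeftContra k C where
  carrier := Module.Dual k N.carrier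
  contra := N.dualContra
  contraunit p := LinearMap.ext fun n => by
    have h : ∀ x : N.carrier ⊗[k] C, TensorProduct.lift
        ((Coalgebra.counit (R := k) (A := C)).smulRight p).flip x =
        p (TensorProduct.rid k N.carrier
          ((Coalgebra.counit (R := k) (A := C)).lTensor N.carrier x)) := by
      intro x
      induction x with
      | zero => simp
      | tmul a b => simp
      | add x y hx hy => simp only [map_add, hx, hy]
    exact (h _).trans (congrArg p (N.counit_apply n))
  contraassoc g := LinearMap.ext fun n => by
    have h1 : ∀ x : N.carrier ⊗[k] C, TensorProduct.lift
        (N.dualContra ∘ₗ (TensorProduct.curry g).flip).flip x =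
        TensorProduct.lift g.flip (TensorProduct.assoc k N.carrier C C (N.coact.rTensor C x)) := by
      intro x
      induction x with
      | zero => simp
      | tmul a b =>
        simp only [TensorProduct.lift.tmul, LinearMap.flip_apply, LinearMap.comp_apply,
          LinearMap.rTensor_tmul, RightComod.dualContra_apply]
        generalize N.coact a = y
        induction y with
        | zero => simp
        | tmul c d => simp
        | add x y hx hy => simp only [map_add, add_tmul, hx, hy]
      | add x y hx hy => simp only [map_add, hx, hy]
    have h2 : ∀ x : N.carrier ⊗[k] C, TensorProduct.lift
        (g ∘ₗ Coalgebra.comul (R := k) (A := C)).flip x =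
        TensorProduct.lift g.flip
          ((Coalgebra.comul (R := k) (A := C)).lTensor N.carrier x) := by
      intro x
      induction x with
      | zero => simp
      | tmul a b => simp
      | add x y hx hy => simp only [map_add, hx, hy]
    exact (h1 _).trans ((congrArg _ (N.coassoc_apply n)).trans (h2 _).symm)

variable (k C) in
/-- The contravariant functor of vector space dualization `N ↦ N*` from right comodules to
left contramodules. -/
def dualFunctor : (RightComod k C)ᵒᵖ ⥤ LeftContra k C where
  obj N := N.unop.dual
  map {M N} f := LeftContra.homMk (RightComod.lin f.unop).dualMap (fun g =>
    LinearMap.ext fun n => by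
      change TensorProduct.lift g.flip (M.unop.coact (RightComod.lin f.unop n)) =
        TensorProduct.lift ((RightComod.lin f.unop).dualMap ∘ₗ g).flip (N.unop.coact n)
      rw [RightComod.lin_comm_apply]
      generalize N.unop.coact n = x
      induction x with
      | zero => simp
      | tmul a b => rfl
      | add x y hx hy => simp only [map_add, hx, hy])

instance : (dualFunctor k C).Additive where
  map_add {M _ _ _} := LeftContra.hom_ext (LinearMap.ext fun p => LinearMap.ext fun _ =>
    map_add (show M.unop.carrier →ₗ[k] k from p) _ _)

lemma dualFunctor_exact :
    PreservesFiniteLimits (dualFunctor k C) ∧ PreservesFiniteColimits (dualFunctor k C) := by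
  refine exact_of_map_shortExact _ fun S hS => ?_
  obtain ⟨h₁, h₂, h₃⟩ := (RightComod.shortExact_iff _).1 hS.unop
  refine (LeftContra.shortExact_iff _).2 ⟨LinearMap.dualMap_injective_of_surjective h₃, ?_,
    LinearMap.dualMap_surjective_of_injective h₁⟩
  rw [LinearMap.exact_iff] at h₂ ⊢
  change (RightComod.lin S.unop.f).dualMap.ker = (RightComod.lin S.unop.g).dualMap.range
  rw [LinearMap.ker_dualMap_eq_dualAnnihilator_range, LinearMap.range_dualMap_eq_dualAnnihilator_ker,
    h₂]

instance : PreservesFiniteLimits (dualFunctor k C) := dualFunctor_exact.1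
instance : PreservesFiniteColimits (dualFunctor k C) := dualFunctor_exact.2

lemma comul_coaug (γ : k →ₗc[k] C) :
    Coalgebra.comul (R := k) (γ 1) = γ 1 ⊗ₜ[k] γ 1 := by
  rw [← CoalgHomClass.map_comp_comul_apply γ 1, CommSemiring.comul_apply, TensorProduct.map_tmul]
  rfl

/-- The one-dimensional right comodule `k` defined by a coaugmentation `γ`: the coaction is
`a ↦ a ⊗ γ(1)`. -/
def trivComod (γ : k →ₗc[k] C) : RightComod k C where
  carrier := k
  coact := (TensorProduct.mk k k C).flip (γ 1)
  counit_coact := by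
    ext
    simp
  coassoc := by
    ext
    simp [comul_coaug]

/-- The one-dimensional left contramodule `k` defined by a coaugmentation `γ`: the contraaction
takes a linear map `g : C → k` to `g (γ(1))`. -/
def trivContra (γ : k →ₗc[k] C) : LeftContra k C where
  carrier := k
  contra := LinearMap.applyₗ (γ 1)
  contraunit p := by simp
  contraassoc g := by simp [comul_coaug]

/-- The canonical isomorphism of the contramodule `k` with the dual `k* = Hom(k, k)` of the
comodule `k`, given by `a ↦ (b ↦ a b)`. -/
def trivIso (γ : k →ₗc[k] C) : trivContra γ ≅ (dualFunctor k C).obj (.op (trivComod γ)) where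
  hom := LeftContra.homMk (LinearMap.mul k k : k →ₗ[k] Module.Dual k k) (fun g =>
    LinearMap.ext fun (b : k) => by
      rfl)
  inv := LeftContra.homMk (LinearMap.applyₗ (1 : k) : Module.Dual k k →ₗ[k] k) (fun g => by
    rfl)
  hom_inv_id := LeftContra.hom_ext (LinearMap.ext fun a => mul_one (M := k) a)
  inv_hom_id := LeftContra.hom_ext (LinearMap.ext fun (p : Module.Dual k k) => LinearMap.ext fun (b : k) => by
    change p 1 * b = p b
    calc p 1 * b = b • p 1 := mul_comm _ _
      _ = p (b • 1) := (map_smul p b 1).symm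
      _ = p b := by simp)

variable {C' : Type u} [AddCommGroup C'] [Module k C'] [Coalgebra k C']

/-- A right `C`-comodule viewed as a right `C'`-comodule via a coalgebra homomorphism `C → C'`. -/
def RightComod.corestrict (f : C →ₗc[k] C') (M : RightComod k C) : RightComod k C' where
  carrier := M.carrier
  coact := f.toLinearMap.lTensor M.carrier ∘ₗ M.coact
  counit_coact := by
    have h : (Coalgebra.counit (R := k) (A := C')) ∘ₗ f.toLinearMap = Coalgebra.counit :=
      f.counit_comp
    rw [← LinearMap.comp_assoc M.coact, ← LinearMap.lTensor_comp, h, M.counit_coact]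
  coassoc := LinearMap.ext fun m => by
    have h : ∀ c, Coalgebra.comul (R := k) (f c) = TensorProduct.map f.toLinearMap f.toLinearMap
      (Coalgebra.comul (R := k) c) := fun c => (CoalgHomClass.map_comp_comul_apply f c).symm
    have h1 : ∀ x : M.carrier ⊗[k] C, TensorProduct.assoc k M.carrier C' C'
        ((f.toLinearMap.lTensor M.carrier ∘ₗ M.coact).rTensor C'
          (f.toLinearMap.lTensor M.carrier x)) =
        (TensorProduct.map f.toLinearMap f.toLinearMap).lTensor M.carrier
          (TensorProduct.assoc k M.carrier C C (M.coact.rTensor C x)) := by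
      intro x
      induction x with
      | zero => simp
      | tmul a b =>
        simp only [LinearMap.lTensor_tmul, LinearMap.rTensor_tmul, LinearMap.comp_apply]
        generalize M.coact a = y
        induction y with
        | zero => simp
        | tmul c d => simp
        | add x y hx hy => simp only [map_add, add_tmul, hx, hy]
      | add x y hx hy => simp only [map_add, hx, hy]
    have h2 : ∀ x : M.carrier ⊗[k] C, (Coalgebra.comul (R := k) (A := C')).lTensor M.carrier
          (f.toLinearMap.lTensor M.carrier x) =
        (TensorProduct.map f.toLinearMap f.toLinearMap).lTensor M.carrier
          ((Coalgebra.comul (R := k) (A := C)).lTensor M.carrier x) := by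
      intro x
      induction x with
      | zero => simp
      | tmul a b =>
        simp only [LinearMap.lTensor_tmul]
        exact congrArg _ (h b)
      | add x y hx hy => simp only [map_add, hx, hy]
    exact (h1 _).trans ((congrArg _ (M.coassoc_apply m)).trans (h2 _).symm)

/-- The corestriction functor on right comodules, for a coalgebra homomorphism `C → C'`. -/
def comodCorestrict (f : C →ₗc[k] C') : RightComod k C ⥤ RightComod k C' where
  obj M := M.corestrict f
  map {M N} g := RightComod.homMk (M := M.corestrict f) (N := N.corestrict f)
    (RightComod.lin (M := M) (N := N) g)
    (LinearMap.ext fun (m : M.carrier) => by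
      change f.toLinearMap.lTensor N.carrier (N.coact (RightComod.lin g m)) =
        (RightComod.lin g).rTensor C' (f.toLinearMap.lTensor M.carrier (M.coact m))
      rw [RightComod.lin_comm_apply]
      generalize M.coact m = x
      induction x with
      | zero => simp
      | tmul a b => simp
      | add x y hx hy => simp only [map_add, hx, hy])

instance (f : C →ₗc[k] C') : (comodCorestrict f).Additive where
instance (f : C →ₗc[k] C') : (comodCorestrict f).Linear k where

lemma comodCorestrict_exact (f : C →ₗc[k] C') :
    PreservesFiniteLimits (comodCorestrict f) ∧ PreservesFiniteColimits (comodCorestrict f) :=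
  exact_of_map_shortExact _ fun S hS =>
    (RightComod.shortExact_iff (S.map (comodCorestrict f))).2 ((RightComod.shortExact_iff S).1 hS)

instance (f : C →ₗc[k] C') : PreservesFiniteLimits (comodCorestrict f) :=
  (comodCorestrict_exact f).1
instance (f : C →ₗc[k] C') : PreservesFiniteColimits (comodCorestrict f) :=
  (comodCorestrict_exact f).2

/-- A left `C`-contramodule viewed as a left `C'`-contramodule via a coalgebra homomorphism
`C → C'`: the contraaction is `Hom(C', P) → Hom(C, P) → P`. -/
def LeftContra.corestrict (f : C →ₗc[k] C') (P : LeftContra k C) : LeftContra k C' where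
  carrier := P.carrier
  contra := P.contra ∘ₗ LinearMap.lcomp k P.carrier f.toLinearMap
  contraunit p := by
    have h : (Coalgebra.counit (R := k) (A := C')) ∘ₗ f.toLinearMap = Coalgebra.counit :=
      f.counit_comp
    refine (congrArg P.contra ?_).trans (P.contraunit p)
    rw [← h]
    rfl
  contraassoc g := by
    have h : Coalgebra.comul (R := k) ∘ₗ f.toLinearMap =
      TensorProduct.map f.toLinearMap f.toLinearMap ∘ₗ Coalgebra.comul (R := k) :=
      f.map_comp_comul.symm
    have e := P.contraassoc (g ∘ₗ TensorProduct.map f.toLinearMap f.toLinearMap)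
    rw [LinearMap.comp_assoc, ← h] at e
    exact e

/-- The corestriction functor on left contramodules, for a coalgebra homomorphism `C → C'`. -/
def contraCorestrict (f : C →ₗc[k] C') : LeftContra k C ⥤ LeftContra k C' where
  obj P := P.corestrict f
  map {P Q} g := LeftContra.homMk (P := P.corestrict f) (Q := Q.corestrict f)
    (LeftContra.lin (P := P) (Q := Q) g)
    (fun x => LeftContra.lin_contra (P := P) (Q := Q) g (x ∘ₗ f.toLinearMap))

instance (f : C →ₗc[k] C') : (contraCorestrict f).Additive where
instance (f : C →ₗc[k] C') : (contraCorestrict f).Linear k where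

lemma contraCorestrict_exact (f : C →ₗc[k] C') :
    PreservesFiniteLimits (contraCorestrict f) ∧ PreservesFiniteColimits (contraCorestrict f) :=
  exact_of_map_shortExact _ fun S hS =>
    (LeftContra.shortExact_iff (S.map (contraCorestrict f))).2 ((LeftContra.shortExact_iff S).1 hS)

instance (f : C →ₗc[k] C') : PreservesFiniteLimits (contraCorestrict f) :=
  (contraCorestrict_exact f).1
instance (f : C →ₗc[k] C') : PreservesFiniteColimits (contraCorestrict f) :=
  (contraCorestrict_exact f).2

/-- For a homomorphism of coaugmented coalgebras, corestriction takes the comodule `k` to the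
comodule `k`. -/
def comodCorestrictTriv (γ : k →ₗc[k] C) (γ' : k →ₗc[k] C') (f : C →ₗc[k] C')
    (h : f.comp γ = γ') : (comodCorestrict f).obj (trivComod γ) ≅ trivComod γ' :=
  have h1 : f (γ 1) = γ' 1 := by rw [← h]; rfl
  { hom := RightComod.homMk (LinearMap.id : k →ₗ[k] k) (LinearMap.ext fun a => by
      change a ⊗ₜ[k] γ' 1 = LinearMap.rTensor C' LinearMap.id (a ⊗ₜ[k] f (γ 1))
      rw [LinearMap.rTensor_id, h1]
      rfl)
    inv := RightComod.homMk (LinearMap.id : k →ₗ[k] k) (LinearMap.ext fun a => by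
      change a ⊗ₜ[k] f (γ 1) = LinearMap.rTensor C' LinearMap.id (a ⊗ₜ[k] γ' 1)
      rw [LinearMap.rTensor_id, h1]
      rfl)
    hom_inv_id := rfl
    inv_hom_id := rfl }

/-- For a homomorphism of coaugmented coalgebras, corestriction takes the contramodule `k` to the
contramodule `k`. -/
def contraCorestrictTriv (γ : k →ₗc[k] C) (γ' : k →ₗc[k] C') (f : C →ₗc[k] C')
    (h : f.comp γ = γ') : (contraCorestrict f).obj (trivContra γ) ≅ trivContra γ' :=
  have h1 : f (γ 1) = γ' 1 := by rw [← h]; rfl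
  { hom := LeftContra.homMk (LinearMap.id : k →ₗ[k] k) (fun g => congrArg g h1)
    inv := LeftContra.homMk (LinearMap.id : k →ₗ[k] k) (fun g => congrArg g h1.symm)
    hom_inv_id := rfl
    inv_hom_id := rfl }

open Abelian

/-- The transport of self-extensions along an isomorphism. -/
noncomputable def extConj {A : Type*} [Category A] [Abelian A] [HasExt A] [Linear k A] {X X' : A}
    (e : X ≅ X') (n : ℕ) : Ext X X n →ₗ[k] Ext X' X' n where
  toFun α := (Ext.mk₀ e.inv).comp (α.comp (Ext.mk₀ e.hom) (add_zero n)) (zero_add n)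
  map_add' α β := by simp
  map_smul' c α := by simp

/-- The vector space `Ext^n(k, k)` in the category of right `C`-comodules. -/
abbrev ComodExt (γ : k →ₗc[k] C) (n : ℕ) : Type (u + 1) := Ext (trivComod γ) (trivComod γ) n

/-- The vector space `Ext^n(k, k)` in the category of left `C`-contramodules. -/
abbrev ContraExt (γ : k →ₗc[k] C) (n : ℕ) : Type (u + 1) := Ext (trivContra γ) (trivContra γ) n

/-- The map from the comodule `Ext^n(k, k)` to the contramodule `Ext^n(k, k)` induced by the exact
contravariant functor of vector space dualization. -/
noncomputable def dualizationExt (γ : k →ₗc[k] C) (n : ℕ) : ComodExt γ n →+ ContraExt γ n :=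
  (extConj (k := k) (trivIso γ).symm n).toAddMonoidHom.comp
    (contraExt (dualFunctor k C) (trivComod γ) (trivComod γ) n)

/-- The map of the comodule Ext spaces induced by a homomorphism of coaugmented coalgebras. -/
noncomputable def comodExtMap (γ : k →ₗc[k] C) (γ' : k →ₗc[k] C') (f : C →ₗc[k] C')
    (h : f.comp γ = γ') (n : ℕ) : ComodExt γ n →ₗ[k] ComodExt γ' n :=
  extConj (comodCorestrictTriv γ γ' f h) n ∘ₗ (comodCorestrict f).mapExtLinearMap k _ _ n

/-- The map of the contramodule Ext spaces induced by a homomorphism of coaugmented coalgebras. -/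
noncomputable def contraExtMap (γ : k →ₗc[k] C) (γ' : k →ₗc[k] C') (f : C →ₗc[k] C')
    (h : f.comp γ = γ') (n : ℕ) : ContraExt γ n →ₗ[k] ContraExt γ' n :=
  extConj (contraCorestrictTriv γ γ' f h) n ∘ₗ (contraCorestrict f).mapExtLinearMap k _ _ n

end Functors

/-!
The isomorphism `Ext^n(k, k) ≃ Ext^n(k, k)**` is the case `N = k` of isomorphisms
`Ext^n(N*, k) ≃ Ext^n(k, N)**` (contramodule Ext on the left, comodule Ext on the right) which are
natural in the right comodule `N` and commute with the connecting maps of short exact sequences of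
comodules. Vector space dualization being exact, both sides are cohomological functors of `N`, so
that such isomorphisms can be built by dimension shifting.

* In degree zero, `Hom(k, N)` is the kernel of `n ↦ ρ(n) - n ⊗ γ(1)`, where `ρ : N → N ⊗ C` is the
  coaction, and a contramodule homomorphism `N* ⟶ k` is a linear map killing the functionals
  `π(g) - g(γ(1))`, which are the functionals factoring through that map. Hence it is a linear map
  `Hom(k, N)* → k`; see `lin_eq_zero_of_dualMap_evalOne` and `homDoubleDualEquiv`.
* The coaction embeds `N` into the cofree comodule `N ⊗ C`, which is injective, and the dual of a
  cofree comodule `V ⊗ C` is the contramodule `Hom(C, V*)` freely generated by `V*`, which is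
  projective. So both sides vanish on cofree comodules in positive degrees, and
  `DoubleDualComparison.exists_succ` passes from degree `n` to degree `n + 1`: both sides are the
  cokernels of the maps induced by the projection `J ⟶ J/N` for an embedding of `N` into a cofree
  comodule `J`.

By the same dimension shifting, two families of maps which commute with connecting maps agree as
soon as they agree in degree zero. This gives both properties of the isomorphism. For the first one
(`DoubleDualComparison.equiv_contraExt`), the map induced by dualization commutes with connecting
maps because it reverses Yoneda products (`contraExt_comp`). For the second one
(`comparison_corestrict`), the comparison isomorphisms over `C'` commute with the connecting maps of
all short exact sequences, and so of the corestrictions of sequences `0 → N → J → J/N → 0` with `J`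
cofree over `C`, although the corestriction of `J` need not be injective over `C'`.
-/

/-! ### Double duals of right exact sequences -/

section DoubleDual

open Module

variable {k : Type*} [Field k]

lemma LinearMap.exact_dualMap {V₀ V₁ V₂ : Type*} [AddCommGroup V₀] [Module k V₀] [AddCommGroup V₁]
    [Module k V₁] [AddCommGroup V₂] [Module k V₂] {a : V₀ →ₗ[k] V₁} {p : V₁ →ₗ[k] V₂}
    (h : Function.Exact a p) : Function.Exact p.dualMap a.dualMap := by
  rw [LinearMap.exact_iff] at h ⊢
  rw [LinearMap.ker_dualMap_eq_dualAnnihilator_range,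
    LinearMap.range_dualMap_eq_dualAnnihilator_ker, h]

/-- An isomorphism between two right exact sequences of vector spaces is determined by its
components at the first two terms. -/
lemma LinearEquiv.exists_of_rightExact {V₀ V₁ V₂ W₀ W₁ W₂ : Type*}
    [AddCommGroup V₀] [Module k V₀] [AddCommGroup V₁] [Module k V₁] [AddCommGroup V₂] [Module k V₂]
    [AddCommGroup W₀] [Module k W₀] [AddCommGroup W₁] [Module k W₁] [AddCommGroup W₂] [Module k W₂]
    {a : V₀ →ₗ[k] V₁} {p : V₁ →ₗ[k] V₂} {b : W₀ →ₗ[k] W₁} {q : W₁ →ₗ[k] W₂}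
    (hap : Function.Exact a p) (hp : Function.Surjective p)
    (hbq : Function.Exact b q) (hq : Function.Surjective q)
    (e₀ : V₀ ≃ₗ[k] W₀) (e₁ : V₁ ≃ₗ[k] W₁) (comm : ∀ x, e₁ (a x) = b (e₀ x)) :
    ∃ e₂ : V₂ ≃ₗ[k] W₂, ∀ x, e₂ (p x) = q (e₁ x) := by
  have h : p.ker.map e₁.toLinearMap = q.ker := by
    rw [hap.linearMap_ker_eq, hbq.linearMap_ker_eq, ← LinearMap.range_comp,
      show e₁.toLinearMap ∘ₗ a = b ∘ₗ e₀.toLinearMap from LinearMap.ext comm,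
      LinearMap.range_comp_of_range_eq_top _ e₀.range]
  refine ⟨(p.quotKerEquivOfSurjective hp).symm ≪≫ₗ Submodule.Quotient.equiv _ _ e₁ h ≪≫ₗ
    q.quotKerEquivOfSurjective hq, fun x => ?_⟩
  have : (p.quotKerEquivOfSurjective hp).symm (p x) = Submodule.Quotient.mk x := by
    rw [LinearEquiv.symm_apply_eq]
    rfl
  simp only [LinearEquiv.trans_apply, this]
  rfl

end DoubleDual

/-! ### Dimension shifting for `Ext^n(D N, Y)` and `Ext^n(X, N)**` -/

section Comparison

open Abelian Opposite Module

universe v w t v' w' t'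

variable {k : Type*} [Field k] {A : Type w} [Category.{v} A] [Abelian A] [Linear k A]
  [HasExt.{t} A] {B : Type w'} [Category.{v'} B] [Abelian B] [Linear k B] [HasExt.{t'} B]

lemma CategoryTheory.Abelian.Ext.exists_comp_extClass_of_injective {X N M L : A}
    {i : N ⟶ M} {p : M ⟶ L} {w : i ≫ p = 0}
    (hS : (ShortComplex.mk i p w).ShortExact) [Injective M] {n : ℕ} (α : Ext X N (n + 1)) :
    ∃ β : Ext X L n, β.comp hS.extClass rfl = α :=
  Ext.covariant_sequence_exact₁ X hS α (Ext.eq_zero_of_injective (I := M) _) rfl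

lemma CategoryTheory.Abelian.Ext.exists_extClass_comp_of_projective {Y N M L : A}
    {i : N ⟶ M} {p : M ⟶ L} {w : i ≫ p = 0}
    (hS : (ShortComplex.mk i p w).ShortExact) [Projective M] {n : ℕ} (α : Ext L Y (n + 1)) :
    ∃ β : Ext N Y n, hS.extClass.comp β (add_comm 1 n) = α :=
  Ext.contravariant_sequence_exact₃ hS Y α (Ext.eq_zero_of_projective (P := M) _) (add_comm 1 n)

variable (k) in
/-- The map `Ext^n(X, N)** → Ext^m(X, N')**` given by the Yoneda product with a class in
`Ext^a(N, N')`, where `n + a = m`. -/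
noncomputable abbrev extDoubleDualMap (X : A) {N N' : A} {a n m : ℕ} (β : Ext N N' a)
    (h : n + a = m) : Dual k (Dual k (Ext X N n)) →ₗ[k] Dual k (Dual k (Ext X N' m)) :=
  (β.postcompOfLinear k X h).dualMap.dualMap

lemma extDoubleDualMap_comp (X : A) {N N' N'' : A} {a b c n m l : ℕ} (β : Ext N N' a)
    (β' : Ext N' N'' b) (h : n + a = m) (h' : m + b = l) (h'' : a + b = c) (h₃ : n + c = l)
    (x : Dual k (Dual k (Ext X N n))) :
    extDoubleDualMap k X (β.comp β' h'') h₃ x =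
      extDoubleDualMap k X β' h' (extDoubleDualMap k X β h x) := by
  apply LinearMap.ext
  intro φ
  refine congrArg x (LinearMap.ext fun α => congrArg φ ?_)
  exact (Ext.comp_assoc α β β' h h'' (by lia)).symm

lemma extDoubleDualMap_id (X : A) {N : A} {n : ℕ} (x : Dual k (Dual k (Ext X N n))) :
    extDoubleDualMap k X (Ext.mk₀ (𝟙 N)) (add_zero n) x = x := by
  apply LinearMap.ext
  intro φ
  refine congrArg x (LinearMap.ext fun α => congrArg φ ?_)
  exact Ext.comp_mk₀_id α

variable (k) in
lemma exact_extDoubleDualMap (X : A) {N M L : A} {i : N ⟶ M} {p : M ⟶ L} {w : i ≫ p = 0}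
    (hS : (ShortComplex.mk i p w).ShortExact) (n : ℕ) :
    Function.Exact (extDoubleDualMap k X (Ext.mk₀ p) (add_zero n))
      (extDoubleDualMap k X hS.extClass (rfl : n + 1 = n + 1)) := by
  refine LinearMap.exact_dualMap (LinearMap.exact_dualMap fun x => ⟨fun h => ?_, ?_⟩)
  · exact Ext.covariant_sequence_exact₃ X hS x rfl h
  · rintro ⟨y, rfl⟩
    change (y.comp (Ext.mk₀ p) (add_zero n)).comp hS.extClass rfl = 0
    have := hS.comp_extClass
    dsimp at this
    rw [Ext.comp_assoc_of_second_deg_zero, this, Ext.comp_zero]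

variable (k) in
lemma surjective_extDoubleDualMap (X : A) {N M L : A} {i : N ⟶ M} {p : M ⟶ L} {w : i ≫ p = 0}
    (hS : (ShortComplex.mk i p w).ShortExact) [Injective M] (n : ℕ) :
    Function.Surjective (extDoubleDualMap k X hS.extClass (rfl : n + 1 = n + 1)) :=
  LinearMap.dualMap_surjective_of_injective (LinearMap.dualMap_injective_of_surjective
    (Ext.exists_comp_extClass_of_injective hS))

variable (D : Aᵒᵖ ⥤ B) [D.Additive] [PreservesFiniteLimits D] [PreservesFiniteColimits D]

omit [HasExt.{t} A] in
lemma extClass_contra_naturality {N M L N' M' L' : A} {i : N ⟶ M} {p : M ⟶ L} {w : i ≫ p = 0}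
    {i' : N' ⟶ M'} {p' : M' ⟶ L'} {w' : i' ≫ p' = 0}
    (hS : (ShortComplex.mk i p w).ShortExact) (hS' : (ShortComplex.mk i' p' w').ShortExact)
    (f : N ⟶ N') (a : M ⟶ M') (b : L ⟶ L') (h₁ : f ≫ i' = i ≫ a) (h₂ : a ≫ p' = p ≫ b) :
    (Ext.mk₀ (D.map f.op)).comp (shortExact_contra D hS).extClass (zero_add 1) =
      (shortExact_contra D hS').extClass.comp (Ext.mk₀ (D.map b.op)) (add_zero 1) := by
  let φ : ShortComplex.mk (D.map p'.op) (D.map i'.op)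
      (by rw [← D.map_comp, ← op_comp, w', op_zero, D.map_zero]) ⟶
      ShortComplex.mk (D.map p.op) (D.map i.op)
      (by rw [← D.map_comp, ← op_comp, w, op_zero, D.map_zero]) :=
    { τ₁ := D.map b.op
      τ₂ := D.map a.op
      τ₃ := D.map f.op
      comm₁₂ := by dsimp; rw [← D.map_comp, ← D.map_comp, ← op_comp, ← op_comp, h₂]
      comm₂₃ := by dsimp; rw [← D.map_comp, ← D.map_comp, ← op_comp, ← op_comp, h₁] }
  exact (ShortComplex.ShortExact.extClass_naturality (shortExact_contra D hS')
    (shortExact_contra D hS) φ).symm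

variable (k) in
/-- A family of isomorphisms `Ext^n(D N, Y) ≃ Ext^n(X, N)**`, natural in `N`, for a fixed
number `n`. -/
structure DoubleDualComparison (X : A) (Y : B) (n : ℕ) where
  /-- the isomorphisms -/
  equiv (N : A) : Ext (D.obj (op N)) Y n ≃ₗ[k] Dual k (Dual k (Ext X N n))
  /-- naturality -/
  naturality {N N' : A} (f : N ⟶ N') (ξ : Ext (D.obj (op N)) Y n) :
    equiv N' ((Ext.mk₀ (D.map f.op)).comp ξ (zero_add n)) =
      extDoubleDualMap k X (Ext.mk₀ f) (add_zero n) (equiv N ξ)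

namespace DoubleDualComparison

variable {D} {X : A} {Y : B} {n : ℕ}

/-- Comparison isomorphisms in the degrees `n` and `n + 1` are compatible if they commute with the
connecting maps of all short exact sequences. -/
def Compatible (T : DoubleDualComparison k D X Y n) (T' : DoubleDualComparison k D X Y (n + 1)) :
    Prop :=
  ∀ {N M L : A} {i : N ⟶ M} {p : M ⟶ L} {w : i ≫ p = 0}
    (hS : (ShortComplex.mk i p w).ShortExact) (ξ : Ext (D.obj (op L)) Y n),
    T'.equiv N ((shortExact_contra D hS).extClass.comp ξ (add_comm 1 n)) =
      extDoubleDualMap k X hS.extClass rfl (T.equiv L ξ)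

/-- Both spaces of degree `n + 1` are cokernels of maps in degree `n` induced by `p`, by the
vanishing of `Ext^(n+1)(D M, Y)` and `Ext^(n+1)(X, M)`. -/
lemma exists_equiv_succ (T : DoubleDualComparison k D X Y n) {N M L : A} {i : N ⟶ M} {p : M ⟶ L}
    {w : i ≫ p = 0} (hS : (ShortComplex.mk i p w).ShortExact) [Injective M]
    [Projective (D.obj (op M))] :
    ∃ e : Ext (D.obj (op N)) Y (n + 1) ≃ₗ[k] Dual k (Dual k (Ext X N (n + 1))),
      ∀ ξ : Ext (D.obj (op L)) Y n,
        e ((shortExact_contra D hS).extClass.comp ξ (add_comm 1 n)) =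
          extDoubleDualMap k X hS.extClass rfl (T.equiv L ξ) := by
  refine LinearEquiv.exists_of_rightExact
    (a := (Ext.mk₀ (D.map p.op)).precompOfLinear k Y (zero_add n))
    (p := (shortExact_contra D hS).extClass.precompOfLinear k Y (add_comm 1 n))
    (fun x => ⟨fun h => ?_, ?_⟩) (fun x => ?_) (exact_extDoubleDualMap k X hS n)
    (surjective_extDoubleDualMap k X hS n) (T.equiv M) (T.equiv L) (fun ξ => T.naturality p ξ)
  · exact Ext.contravariant_sequence_exact₁ (shortExact_contra D hS) Y x (add_comm 1 n) h
  · rintro ⟨y, rfl⟩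
    exact (shortExact_contra D hS).extClass_comp_assoc y (h := add_comm 1 n)
  · exact Ext.exists_extClass_comp_of_projective (shortExact_contra D hS) x

/-- Dimension shifting: comparison isomorphisms in degree `n` determine comparison isomorphisms in
degree `n + 1`. -/
lemma exists_succ (T : DoubleDualComparison k D X Y n)
    (hD : ∀ N : A, ∃ (J : A) (i : N ⟶ J), Mono i ∧ Injective J ∧ Projective (D.obj (op J))) :
    ∃ T' : DoubleDualComparison k D X Y (n + 1), T.Compatible T' := by
  have hD' : ∀ N : A, ∃ (J Q : A) (i : N ⟶ J) (p : J ⟶ Q) (w : i ≫ p = 0),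
      (ShortComplex.mk i p w).ShortExact ∧ Injective J ∧ Projective (D.obj (op J)) := by
    intro N
    obtain ⟨J, i, _, hJ, hJ'⟩ := hD N
    exact ⟨J, _, i, cokernel.π i, cokernel.condition i,
      { exact := ShortComplex.exact_cokernel i }, hJ, hJ'⟩
  choose J Q i p w hS hJ hJ' using hD'
  choose e he using fun N => T.exists_equiv_succ (hS N)
  -- Compatibility with all connecting maps and naturality are two cases of one identity.
  have key : ∀ {N M L N' : A} {i' : N ⟶ M} {p' : M ⟶ L} {w' : i' ≫ p' = 0}
      (hS' : (ShortComplex.mk i' p' w').ShortExact) (f : N ⟶ N') (ξ : Ext (D.obj (op L)) Y n),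
      e N' ((Ext.mk₀ (D.map f.op)).comp
        ((shortExact_contra D hS').extClass.comp ξ (add_comm 1 n)) (zero_add _)) =
      extDoubleDualMap k X (Ext.mk₀ f) (add_zero _)
        (extDoubleDualMap k X hS'.extClass rfl (T.equiv L ξ)) := by
    intro N M L N' i' p' w' hS' f ξ
    have := hS'.mono_f
    have := hS'.epi_g
    dsimp at *
    -- As `J N'` is injective, `f` extends to a morphism of short exact sequences.
    let a : M ⟶ J N' := Injective.factorThru (f ≫ i N') i'
    have ha : i' ≫ a = f ≫ i N' := Injective.comp_factorThru _ _
    let b : L ⟶ Q N' := hS'.exact.desc (a ≫ p N') (by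
      dsimp
      rw [reassoc_of% ha, w, comp_zero])
    have hb : p' ≫ b = a ≫ p N' := hS'.exact.g_desc _ _
    have h1 := extClass_contra_naturality D hS' (hS N') f a b ha.symm hb.symm
    have h2 := ShortComplex.ShortExact.extClass_naturality hS' (hS N')
      { τ₁ := f, τ₂ := a, τ₃ := b, comm₁₂ := ha.symm, comm₂₃ := hb.symm }
    dsimp at h2
    rw [← Ext.comp_assoc _ _ _ (zero_add 1) (add_comm 1 n) (by lia), h1,
      Ext.comp_assoc_of_second_deg_zero, he, T.naturality,
      ← extDoubleDualMap_comp X _ _ _ _ (zero_add 1) rfl, ← h2,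
      extDoubleDualMap_comp X _ _ _ _ (add_zero 1) rfl]
  refine ⟨⟨e, fun {N N'} f ξ => ?_⟩, fun {N M L i' p' w'} hS' ξ => ?_⟩
  · obtain ⟨ξ, rfl⟩ := Ext.exists_extClass_comp_of_projective (shortExact_contra D (hS N)) ξ
    rw [key (hS N) f ξ, he]
  · have := key hS' (𝟙 N) ξ
    rw [op_id, D.map_id, Ext.mk₀_id_comp, extDoubleDualMap_id] at this
    exact this

/-- Comparison isomorphisms in degree zero extend to compatible comparison isomorphisms in all
degrees. -/
lemma exists_family (T₀ : DoubleDualComparison k D X Y 0)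
    (hD : ∀ N : A, ∃ (J : A) (i : N ⟶ J), Mono i ∧ Injective J ∧ Projective (D.obj (op J))) :
    ∃ T : ∀ n, DoubleDualComparison k D X Y n, T 0 = T₀ ∧ ∀ n, (T n).Compatible (T (n + 1)) := by
  choose s hs using fun n (T : DoubleDualComparison k D X Y n) => T.exists_succ hD
  exact ⟨fun n => Nat.rec T₀ s n, rfl, fun n => hs n _⟩

end DoubleDualComparison

/-! ### Yoneda products and contravariant exact functors -/

lemma contraExt_extClass {Z M X : A} {i : Z ⟶ M} {p : M ⟶ X} {w : i ≫ p = 0}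
    (hS : (ShortComplex.mk i p w).ShortExact) :
    contraExt D X Z 1 hS.extClass = (shortExact_contra D hS).extClass := by
  have h := contraExt_extClass_comp D hS (Ext.mk₀ (𝟙 Z))
  rw [contraExt_mk₀, op_id, D.map_id, Ext.mk₀_id_comp] at h
  rw [← h]
  congr 1
  exact (Ext.comp_mk₀_id _).symm

/-- The map of Ext groups induced by a contravariant exact functor reverses Yoneda products, without
signs: it is defined on the Yoneda products of short exact sequences, so that this reduces to
associativity. -/
lemma contraExt_comp {X Y Z : A} {a b c : ℕ} (α : Ext X Y a) (β : Ext Y Z b) (h : a + b = c) :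
    contraExt D X Z c (α.comp β h) =
      (contraExt D Y Z b β).comp (contraExt D X Y a α) (by lia) := by
  induction a generalizing X c with
  | zero =>
    obtain rfl : b = c := by lia
    obtain ⟨f, rfl⟩ := Ext.addEquiv₀.symm.surjective α
    rw [Ext.addEquiv₀_symm_apply, contraExt_mk₀]
    exact (ContraExtMaps.all D b).naturality f β
  | succ a ih =>
    obtain ⟨N, M, i, p, w, hS, α, rfl⟩ := exists_extClass_comp α
    obtain rfl : c = (a + b) + 1 := by lia
    rw [Ext.comp_assoc _ _ _ (add_comm 1 a) rfl (by lia), contraExt_extClass_comp,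
      contraExt_extClass_comp, ih, Ext.comp_assoc _ _ _ (by lia) rfl (by lia)]

namespace DoubleDualComparison

variable {D} {X : A} {Y : B}

/-- Compatible comparison isomorphisms take the classes obtained by applying the functor `D` to
elements of the double dual space given by evaluation as soon as they do in degree zero. -/
lemma equiv_contraExt (T : ∀ n, DoubleDualComparison k D X Y n)
    (hT : ∀ n, (T n).Compatible (T (n + 1))) [EnoughInjectives A] (y : D.obj (op X) ⟶ Y)
    (h₀ : ∀ {N : A} (f : X ⟶ N), (T 0).equiv N (Ext.mk₀ (D.map f.op ≫ y)) =
      Dual.eval k _ (Ext.mk₀ f)) {n : ℕ} {N : A} (α : Ext X N n) :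
    (T n).equiv N ((contraExt D X N n α).comp (Ext.mk₀ y) (add_zero n)) = Dual.eval k _ α := by
  induction n generalizing N with
  | zero =>
    obtain ⟨f, rfl⟩ := Ext.addEquiv₀.symm.surjective α
    rw [Ext.addEquiv₀_symm_apply, contraExt_mk₀, Ext.mk₀_comp_mk₀, h₀]
  | succ n ih =>
    have hS : (ShortComplex.mk (Injective.ι N) _ (cokernel.condition _)).ShortExact :=
      { exact := ShortComplex.exact_cokernel (Injective.ι N) }
    obtain ⟨α, rfl⟩ := Ext.exists_comp_extClass_of_injective hS α
    rw [contraExt_comp, contraExt_extClass, Ext.comp_assoc_of_third_deg_zero, hT, ih]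
    rfl

end DoubleDualComparison

end Comparison

/-! ### Cofree comodules and their duals -/

section Cofree

variable {k C : Type u} [Field k] [AddCommGroup C] [Module k C] [Coalgebra k C]

namespace RightComod

lemma injective_lin {M N : RightComod k C} (f : M ⟶ N) [Mono f] : Function.Injective (lin f) :=
  ((shortExact_iff (ShortComplex.mk f (cokernel.π f) (cokernel.condition f))).1
    { exact := ShortComplex.exact_cokernel f }).1

lemma coact_injective (M : RightComod k C) : Function.Injective M.coact := fun x y h => by
  rw [← M.counit_apply x, h, M.counit_apply]

section

variable (V : Type u) [AddCommGroup V] [Module k V]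

variable (k C) in
/-- The coaction `v ⊗ c ↦ v ⊗ μ(c)` on `V ⊗ C`. -/
noncomputable def cofreeCoact : V ⊗[k] C →ₗ[k] (V ⊗[k] C) ⊗[k] C :=
  (TensorProduct.assoc k V C C).symm.toLinearMap ∘ₗ
    (Coalgebra.comul (R := k) (A := C)).lTensor V

lemma cofreeCoact_tmul (v : V) (c : C) : cofreeCoact k C V (v ⊗ₜ c) =
    (TensorProduct.mk k V C v).rTensor C (Coalgebra.comul (R := k) c) := by
  change (TensorProduct.assoc k V C C).symm (v ⊗ₜ Coalgebra.comul (R := k) c) = _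
  generalize Coalgebra.comul (R := k) c = x
  induction x with
  | zero => simp
  | tmul a b => simp
  | add x y hx hy => simp only [map_add, tmul_add, hx, hy]

variable (k C) in
/-- The cofree right comodule `V ⊗ C`. -/
noncomputable def cofree : RightComod k C where
  carrier := V ⊗[k] C
  coact := cofreeCoact k C V
  counit_coact := by
    apply TensorProduct.ext'
    intro v c
    have h := congrArg ((TensorProduct.mk k V C v) ∘ₗ (TensorProduct.rid k C).toLinearMap)
      (Coalgebra.lTensor_counit_comul (R := k) c)
    simp only [LinearMap.comp_apply, LinearEquiv.coe_coe, TensorProduct.rid_tmul, one_smul,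
      TensorProduct.mk_apply, LinearMap.id_apply] at h ⊢
    rw [cofreeCoact_tmul]
    refine Eq.trans ?_ h
    generalize Coalgebra.comul (R := k) c = x
    induction x with
    | zero => simp
    | tmul a b => simp
    | add x y hx hy => simp only [map_add, tmul_add, hx, hy]
  coassoc := by
    apply TensorProduct.ext'
    intro v c
    have h := congrArg ((TensorProduct.mk k V C v).rTensor (C ⊗[k] C))
      (Coalgebra.coassoc_apply (R := k) c)
    simp only [LinearMap.comp_apply, LinearEquiv.coe_coe]
    rw [cofreeCoact_tmul]
    refine Eq.trans ?_ (h.trans ?_)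
    · generalize Coalgebra.comul (R := k) c = x
      induction x with
      | zero => simp
      | tmul a b =>
        simp only [LinearMap.rTensor_tmul, TensorProduct.mk_apply, cofreeCoact_tmul]
        generalize Coalgebra.comul (R := k) a = y
        induction y with
        | zero => simp
        | tmul c d => simp
        | add x y hx hy => simp only [map_add, add_tmul, hx, hy]
      | add x y hx hy => simp only [map_add, hx, hy]
    · generalize Coalgebra.comul (R := k) c = x
      induction x with
      | zero => simp
      | tmul a b => simp
      | add x y hx hy => simp only [map_add, hx, hy]

end

variable {V : Type u} [AddCommGroup V] [Module k V]

/-- The comodule homomorphism `M ⟶ V ⊗ C` corresponding to a linear map `M → V`. -/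
noncomputable def cofreeLift {M : RightComod k C} (g : M.carrier →ₗ[k] V) : M ⟶ cofree k C V :=
  homMk (N := cofree k C V) (g.rTensor C ∘ₗ M.coact) (LinearMap.ext fun m => by
    change cofreeCoact k C V (g.rTensor C (M.coact m)) =
      (g.rTensor C ∘ₗ M.coact).rTensor C (M.coact m)
    have h1 : ∀ x, cofreeCoact k C V (g.rTensor C x) = (TensorProduct.assoc k V C C).symm
        (g.rTensor (C ⊗[k] C) ((Coalgebra.comul (R := k) (A := C)).lTensor M.carrier x)) := by
      intro x
      induction x with
      | zero => simp
      | tmul a b => simp [cofreeCoact]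
      | add x y hx hy => simp only [map_add, hx, hy]
    have h2 : ∀ x, (g.rTensor C ∘ₗ M.coact).rTensor C x = (TensorProduct.assoc k V C C).symm
        (g.rTensor (C ⊗[k] C) (TensorProduct.assoc k M.carrier C C (M.coact.rTensor C x))) := by
      intro x
      induction x with
      | zero => simp
      | tmul a b =>
        simp only [LinearMap.rTensor_tmul, LinearMap.comp_apply]
        generalize M.coact a = y
        induction y with
        | zero => simp
        | tmul c d => simp
        | add x y hx hy => simp only [map_add, add_tmul, hx, hy]
      | add x y hx hy => simp only [map_add, hx, hy]
    rw [h1, h2, M.coassoc_apply])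

lemma lin_cofreeLift {M : RightComod k C} (g : M.carrier →ₗ[k] V) :
    lin (cofreeLift g) = g.rTensor C ∘ₗ M.coact := rfl

lemma comp_cofreeLift {M N : RightComod k C} (f : M ⟶ N) (g : N.carrier →ₗ[k] V) :
    f ≫ cofreeLift g = cofreeLift (g ∘ₗ lin f) := by
  apply hom_ext
  change g.rTensor C ∘ₗ (N.coact ∘ₗ lin f) = (g ∘ₗ lin f).rTensor C ∘ₗ M.coact
  rw [lin_comm, LinearMap.rTensor_comp, LinearMap.comp_assoc]

/-- The projection `V ⊗ C → V` defined by the counit. -/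
noncomputable def cofreeCounit : (cofree k C V).carrier →ₗ[k] V :=
  (TensorProduct.rid k V).toLinearMap ∘ₗ (Coalgebra.counit (R := k) (A := C)).lTensor V

/-- One of the triangle identities for the adjunction between the forgetful functor and
`V ↦ V ⊗ C`. -/
lemma cofreeLift_cofreeCounit :
    cofreeLift (M := cofree k C V) cofreeCounit = 𝟙 (cofree k C V) := by
  apply hom_ext
  apply TensorProduct.ext'
  intro v c
  have e := congrArg ((TensorProduct.mk k V C v) ∘ₗ (TensorProduct.lid k C).toLinearMap)
    (Coalgebra.rTensor_counit_comul (R := k) c)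
  simp only [LinearMap.comp_apply, LinearEquiv.coe_coe, TensorProduct.lid_tmul, one_smul,
    TensorProduct.mk_apply] at e
  change ((TensorProduct.rid k V).toLinearMap ∘ₗ
    (Coalgebra.counit (R := k) (A := C)).lTensor V).rTensor C (cofreeCoact k C V (v ⊗ₜ c)) =
      v ⊗ₜ[k] c
  rw [cofreeCoact_tmul]
  refine Eq.trans ?_ e
  generalize Coalgebra.comul (R := k) c = x
  induction x with
  | zero => simp
  | tmul a b => simp [smul_tmul]
  | add x y hx hy => simp only [map_add, tmul_add, hx, hy]

lemma cofreeLift_counit {M : RightComod k C} (h : M ⟶ cofree k C V) :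
    cofreeLift (cofreeCounit ∘ₗ lin h) = h := by
  rw [← comp_cofreeLift, cofreeLift_cofreeCounit, Category.comp_id]

instance : Injective (cofree k C V) where
  factors {M N} h f _ := by
    obtain ⟨s, hs⟩ := (lin f).exists_leftInverse_of_injective
      (LinearMap.ker_eq_bot.2 (injective_lin f))
    refine ⟨cofreeLift ((cofreeCounit ∘ₗ lin h) ∘ₗ s), ?_⟩
    rw [comp_cofreeLift, LinearMap.comp_assoc, hs, LinearMap.comp_id, cofreeLift_counit]

variable (k C V) in
/-- The bilinear map `(v, c) ↦ v ⊗ c` with values in the cofree comodule. -/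
noncomputable def cofreeMk : V →ₗ[k] C →ₗ[k] (cofree k C V).carrier := TensorProduct.mk k V C

lemma coact_cofreeMk (v : V) (c : C) : (cofree k C V).coact (cofreeMk k C V v c) =
    (cofreeMk k C V v).rTensor C (Coalgebra.comul (R := k) c) := cofreeCoact_tmul V v c

/-- The coaction of a comodule `M` as a comodule homomorphism into the cofree comodule `M ⊗ C`. -/
noncomputable def toCofree (M : RightComod k C) : M ⟶ cofree k C M.carrier :=
  cofreeLift LinearMap.id

instance (M : RightComod k C) : Mono (toCofree M) := by
  refine (forget k C).mono_of_mono_map ((ModuleCat.mono_iff_injective _).2 ?_)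
  change Function.Injective (lin (toCofree M))
  rw [toCofree, lin_cofreeLift, LinearMap.rTensor_id]
  exact M.coact_injective

instance : EnoughInjectives (RightComod k C) where
  presentation M := ⟨⟨cofree k C M.carrier, inferInstance, toCofree M, inferInstance⟩⟩

end RightComod

namespace LeftContra

open Module

lemma surjective_lin {P Q : LeftContra k C} (f : P ⟶ Q) [Epi f] : Function.Surjective (lin f) :=
  ((shortExact_iff (ShortComplex.mk (kernel.ι f) f (kernel.condition f))).1
    { exact := ShortComplex.exact_kernel f }).2.2

variable {V : Type u} [AddCommGroup V] [Module k V]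

/-- The isomorphism `(V ⊗ C)* ≃ Hom(C, V*)`, as a linear map. -/
noncomputable def dualCofreeCurry :
    Dual k (RightComod.cofree k C V).carrier →ₗ[k] C →ₗ[k] Dual k V where
  toFun φ := ((RightComod.cofreeMk k C V).compr₂ φ).flip
  map_add' _ _ := rfl
  map_smul' _ _ := rfl

lemma dualCofreeCurry_apply (φ : Dual k (RightComod.cofree k C V).carrier) (c : C) (v : V) :
    dualCofreeCurry φ c v = φ (RightComod.cofreeMk k C V v c) := rfl

lemma dual_cofree_ext {φ ψ : Dual k (RightComod.cofree k C V).carrier}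
    (h : ∀ v c, φ (RightComod.cofreeMk k C V v c) = ψ (RightComod.cofreeMk k C V v c)) : φ = ψ :=
  TensorProduct.ext' h

lemma dualContra_cofreeMk (g : C →ₗ[k] Dual k (RightComod.cofree k C V).carrier) (v : V) (c : C) :
    (RightComod.cofree k C V).dualContra g (RightComod.cofreeMk k C V v c) =
      TensorProduct.lift (g.compl₂ (RightComod.cofreeMk k C V v)).flip
        (Coalgebra.comul (R := k) c) := by
  rw [RightComod.dualContra_apply, RightComod.coact_cofreeMk]
  generalize Coalgebra.comul (R := k) c = x
  induction x with
  | zero => simp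
  | tmul a b => simp
  | add x y hx hy => simp only [map_add, hx, hy]

/-- The contramodule homomorphism `(V ⊗ C)* ⟶ P` corresponding to a linear map `V* → P`: the
contramodule `(V ⊗ C)* ≃ Hom(C, V*)` is freely generated by `V*`. -/
noncomputable def freeLift {P : LeftContra k C} (q : Dual k V →ₗ[k] P.carrier) :
    (RightComod.cofree k C V).dual ⟶ P :=
  homMk (P := (RightComod.cofree k C V).dual)
    (P.contra ∘ₗ LinearMap.compRight k q ∘ₗ dualCofreeCurry) (fun g => by
    change C →ₗ[k] Dual k (RightComod.cofree k C V).carrier at g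
    -- `G (c ⊗ c') = q (v ↦ g c' (v ⊗ c))`, in the order required by contraassociativity.
    let G : C ⊗[k] C →ₗ[k] P.carrier :=
      TensorProduct.lift ((LinearMap.compRight k q ∘ₗ dualCofreeCurry) ∘ₗ g).flip
    refine Eq.trans ?_ ((P.contraassoc G).symm.trans ?_)
    · change P.contra (q ∘ₗ dualCofreeCurry ((RightComod.cofree k C V).dualContra g)) = _
      congr 1
      apply LinearMap.ext
      intro c
      have : dualCofreeCurry ((RightComod.cofree k C V).dualContra g) c =
          TensorProduct.lift (dualCofreeCurry ∘ₗ g).flip (Coalgebra.comul (R := k) c) := by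
        apply LinearMap.ext
        intro v
        rw [dualCofreeCurry_apply, dualContra_cofreeMk]
        generalize Coalgebra.comul (R := k) c = x
        induction x with
        | zero => simp
        | tmul a b => rfl
        | add x y hx hy => simp only [map_add, hx, hy, LinearMap.add_apply]
      rw [LinearMap.comp_apply, this, LinearMap.comp_apply]
      generalize Coalgebra.comul (R := k) c = x
      induction x with
      | zero => simp
      | tmul a b => rfl
      | add x y hx hy => simp only [map_add, hx, hy]
    · rfl)

variable (k C V) in
/-- The embedding `V* → (V ⊗ C)*` of the space of free generators. -/
noncomputable def freeUnit : Dual k V →ₗ[k] (RightComod.cofree k C V).dual.carrier :=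
  RightComod.cofreeCounit.dualMap

lemma freeLift_comp {P Q : LeftContra k C} (q : Dual k V →ₗ[k] P.carrier) (f : P ⟶ Q) :
    freeLift q ≫ f = freeLift (lin f ∘ₗ q) :=
  hom_ext (LinearMap.ext fun φ => lin_contra f (q ∘ₗ dualCofreeCurry φ))

/-- The canonical linear map `V* → (V ⊗ C)*` generates: every `φ` is the contraaction of
`c ↦ freeUnit (v ↦ φ (v ⊗ c))`. -/
lemma freeLift_freeUnit : freeLift (freeUnit k C V) = 𝟙 _ := by
  apply hom_ext
  apply LinearMap.ext
  intro (φ : Dual k (RightComod.cofree k C V).carrier)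
  apply dual_cofree_ext
  intro v c
  refine (dualContra_cofreeMk _ v c).trans ?_
  have e := congrArg (φ ∘ₗ (RightComod.cofreeMk k C V v) ∘ₗ (TensorProduct.lid k C).toLinearMap)
    (Coalgebra.rTensor_counit_comul (R := k) c)
  simp only [LinearMap.comp_apply, LinearEquiv.coe_coe, TensorProduct.lid_tmul, one_smul] at e
  refine Eq.trans ?_ e
  generalize Coalgebra.comul (R := k) c = x
  induction x with
  | zero => simp
  | tmul a b =>
    change φ (RightComod.cofreeMk k C V (Coalgebra.counit (R := k) a • v) b) = _
    simp
  | add x y hx hy => simp only [map_add, hx, hy]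

lemma freeLift_unit {P : LeftContra k C} (h : (RightComod.cofree k C V).dual ⟶ P) :
    freeLift (lin h ∘ₗ freeUnit k C V) = h := by
  rw [← freeLift_comp, freeLift_freeUnit, Category.id_comp]

instance : Projective (RightComod.cofree k C V).dual where
  factors {P Q} h f _ := by
    obtain ⟨s, hs⟩ := (lin f).exists_rightInverse_of_surjective
      (LinearMap.range_eq_top.2 (surjective_lin f))
    refine ⟨freeLift (s ∘ₗ lin h ∘ₗ freeUnit k C V), ?_⟩
    rw [freeLift_comp, ← LinearMap.comp_assoc, hs, LinearMap.id_comp, freeLift_unit]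

end LeftContra
end Cofree

/-! ### The comparison for the comodule `k` and the contramodule `k` -/

section DegreeZero

open Module Abelian Opposite

variable {k C : Type u} [Field k] [AddCommGroup C] [Module k C] [Coalgebra k C]

/-- The comodule homomorphism `k ⟶ N` taking `1` to an element `n` with `ρ(n) = n ⊗ γ(1)`, where
`ρ` is the coaction of `N`. -/
def trivComodHomMk (γ : k →ₗc[k] C) {N : RightComod k C} (n : N.carrier)
    (hn : N.coact n = n ⊗ₜ γ 1) : trivComod γ ⟶ N :=
  RightComod.homMk (M := trivComod γ) (LinearMap.toSpanSingleton k N.carrier n)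
    (LinearMap.ext_ring (by
      change N.coact ((1 : k) • n) =
        (LinearMap.toSpanSingleton k N.carrier n).rTensor C ((1 : k) ⊗ₜ γ 1)
      rw [LinearMap.rTensor_tmul, LinearMap.toSpanSingleton_apply, one_smul, hn]))

variable (γ : k →ₗc[k] C) (N : RightComod k C)

/-- The embedding `Hom(k, N) → N` given by the value at `1`. -/
def evalOne : (trivComod γ ⟶ N) →ₗ[k] N.carrier where
  toFun f := RightComod.lin f (1 : k)
  map_add' _ _ := rfl
  map_smul' _ _ := rfl

lemma evalOne_injective : Function.Injective (evalOne γ N) := fun _ _ h =>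
  RightComod.hom_ext (LinearMap.ext_ring h)

lemma coact_evalOne (f : trivComod γ ⟶ N) : N.coact (evalOne γ N f) = evalOne γ N f ⊗ₜ γ 1 :=
  (RightComod.lin_comm_apply f (1 : k)).trans (LinearMap.rTensor_tmul _ _ _ _)

/-- The contramodule homomorphism `N* ⟶ k` defined by an element of `Hom(k, N)**`. -/
def homOfDoubleDual (T : Dual k (Dual k (trivComod γ ⟶ N))) :
    (dualFunctor k C).obj (op N) ⟶ trivContra γ :=
  LeftContra.homMk (P := N.dual) (Q := trivContra γ)
    (T ∘ₗ (evalOne γ N).dualMap) (fun g => congrArg T (LinearMap.ext fun f => by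
      change C →ₗ[k] Dual k N.carrier at g
      change N.dualContra g (evalOne γ N f) = g (γ 1) (evalOne γ N f)
      rw [RightComod.dualContra_apply, coact_evalOne]
      rfl))

/-- A contramodule homomorphism `N* ⟶ k` vanishes on the functionals which vanish on the image of
`Hom(k, N)`: such a functional factors through `n ↦ ρ(n) - n ⊗ γ(1)`, where `ρ` is the coaction. -/
lemma lin_eq_zero_of_dualMap_evalOne (h : (dualFunctor k C).obj (op N) ⟶ trivContra γ)
    (φ : Dual k N.carrier)
    (hφ : (evalOne γ N).dualMap φ = 0) : LeftContra.lin h φ = (0 : k) := by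
  let d : N.carrier →ₗ[k] N.carrier ⊗[k] C :=
    N.coact - (TensorProduct.mk k N.carrier C).flip (γ 1)
  have hd : φ ∈ d.dualMap.range := by
    rw [LinearMap.range_dualMap_eq_dualAnnihilator_ker, Submodule.mem_dualAnnihilator]
    intro n hn
    have := LinearMap.congr_fun hφ (trivComodHomMk γ n (sub_eq_zero.1 hn))
    change φ ((1 : k) • n) = 0 at this
    rwa [one_smul] at this
  obtain ⟨μ, rfl⟩ := hd
  let g : C →ₗ[k] Dual k N.carrier := (TensorProduct.curry μ).flip
  have e : d.dualMap μ = N.dualContra g - g (γ 1) := by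
    apply LinearMap.ext
    intro n
    have : TensorProduct.lift g.flip = μ := TensorProduct.ext' fun _ _ => rfl
    rw [LinearMap.sub_apply, RightComod.dualContra_apply, this]
    exact map_sub μ _ _
  rw [e]
  refine (map_sub (LeftContra.lin h) _ _).trans (sub_eq_zero.2 ?_)
  exact LeftContra.lin_contra h g

/-- The isomorphism `Hom(k, N)** ≃ Hom(N*, k)`. -/
noncomputable def homDoubleDualEquiv :
    Dual k (Dual k (trivComod γ ⟶ N)) ≃ₗ[k] ((dualFunctor k C).obj (op N) ⟶ trivContra γ) :=
  have hs : Function.Surjective (evalOne γ N).dualMap :=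
    LinearMap.dualMap_surjective_of_injective (evalOne_injective γ N)
  LinearEquiv.ofBijective
    { toFun := homOfDoubleDual γ N
      map_add' := fun _ _ => rfl
      map_smul' := fun _ _ => rfl }
    (by
      constructor
      · intro T T' h
        apply LinearMap.ext
        intro ψ
        obtain ⟨φ, rfl⟩ := hs ψ
        exact LinearMap.congr_fun (congrArg LeftContra.lin h) φ
      · intro h
        obtain ⟨s, hs'⟩ := (evalOne γ N).dualMap.exists_rightInverse_of_surjective
          (LinearMap.range_eq_top.2 hs)
        refine ⟨(LeftContra.lin h : Dual k N.carrier →ₗ[k] k) ∘ₗ s, LeftContra.hom_ext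
          (LinearMap.ext fun (φ : Dual k N.carrier) => sub_eq_zero.1 ?_)⟩
        refine (map_sub (LeftContra.lin h : Dual k N.carrier →ₗ[k] k)
          (s ((evalOne γ N).dualMap φ)) φ).symm.trans ?_
        refine lin_eq_zero_of_dualMap_evalOne γ N h _ ?_
        rw [map_sub, sub_eq_zero]
        exact LinearMap.congr_fun hs' _)

/-- The isomorphism `Ext^0(N*, k) ≃ Ext^0(k, N)**`. -/
noncomputable def extZeroEquiv :
    Ext ((dualFunctor k C).obj (op N)) (trivContra γ) 0 ≃ₗ[k]
      Dual k (Dual k (Ext (trivComod γ) N 0)) :=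
  Ext.linearEquiv₀ (R := k) ≪≫ₗ (homDoubleDualEquiv γ N).symm ≪≫ₗ
    (Ext.linearEquiv₀ (R := k) (X := trivComod γ) (Y := N)).symm.dualMap.dualMap

lemma extZeroEquiv_mk₀ (T : Dual k (Dual k (trivComod γ ⟶ N))) :
    extZeroEquiv γ N (Ext.mk₀ (homOfDoubleDual γ N T)) =
      (Ext.linearEquiv₀ (R := k) (X := trivComod γ) (Y := N)).symm.dualMap.dualMap T := by
  have h : Ext.linearEquiv₀ (R := k) (Ext.mk₀ (homOfDoubleDual γ N T)) =
      homDoubleDualEquiv γ N T := by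
    rw [← Ext.linearEquiv₀_symm_apply (R := k), LinearEquiv.apply_symm_apply]
    rfl
  rw [extZeroEquiv, LinearEquiv.trans_apply, LinearEquiv.trans_apply, h,
    LinearEquiv.symm_apply_apply]

/-- The comparison isomorphisms in degree zero. -/
noncomputable def comparisonZero :
    DoubleDualComparison k (dualFunctor k C) (trivComod γ) (trivContra γ) 0 where
  equiv N := extZeroEquiv γ N
  naturality {N N'} f ξ := by
    obtain ⟨h, rfl⟩ := (Ext.linearEquiv₀ (R := k)).symm.surjective ξ
    obtain ⟨T, rfl⟩ := (homDoubleDualEquiv γ N).surjective h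
    have e : (dualFunctor k C).map f.op ≫ homDoubleDualEquiv γ N T =
        homOfDoubleDual γ N' ((Linear.rightComp k (trivComod γ) f).dualMap.dualMap T) := rfl
    rw [Ext.linearEquiv₀_symm_apply, Ext.mk₀_comp_mk₀, e]
    refine (extZeroEquiv_mk₀ γ N' _).trans
      (Eq.trans ?_ (congrArg _ (extZeroEquiv_mk₀ γ N T)).symm)
    apply LinearMap.ext
    intro ψ
    refine congrArg T (LinearMap.ext fun g => congrArg ψ ?_)
    exact (Ext.mk₀_comp_mk₀ g f).symm

lemma comparisonZero_mk₀ {N : RightComod k C} (f : trivComod γ ⟶ N) :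
    (comparisonZero γ).equiv N (Ext.mk₀ ((dualFunctor k C).map f.op ≫ (trivIso γ).inv)) =
      Dual.eval k _ (Ext.mk₀ f) :=
  extZeroEquiv_mk₀ γ N (Dual.eval k _ f)

/-- The embedding of a comodule into the cofree comodule which effaces both sides of the comparison
in positive degrees. -/
lemma exists_mono_injective_projective (N : RightComod k C) : ∃ (J : RightComod k C) (i : N ⟶ J),
    Mono i ∧ Injective J ∧ Projective ((dualFunctor k C).obj (op J)) :=
  ⟨RightComod.cofree k C N.carrier, RightComod.toCofree N, inferInstance, inferInstance,
    inferInstanceAs (Projective (RightComod.cofree k C N.carrier).dual)⟩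

/-- The comparison isomorphisms `Ext^n(N*, k) ≃ Ext^n(k, N)**` in all degrees. -/
noncomputable def comparison :
    ∀ n, DoubleDualComparison k (dualFunctor k C) (trivComod γ) (trivContra γ) n :=
  ((comparisonZero γ).exists_family exists_mono_injective_projective).choose

lemma comparison_zero : comparison γ 0 = comparisonZero γ :=
  ((comparisonZero γ).exists_family exists_mono_injective_projective).choose_spec.1

lemma comparison_compatible (n : ℕ) : (comparison γ n).Compatible (comparison γ (n + 1)) :=
  ((comparisonZero γ).exists_family exists_mono_injective_projective).choose_spec.2 n

lemma comparison_contraExt {n : ℕ} {N : RightComod k C} (α : Ext (trivComod γ) N n) :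
    (comparison γ n).equiv N ((contraExt (dualFunctor k C) _ N n α).comp
      (Ext.mk₀ (trivIso γ).inv) (add_zero n)) = Dual.eval k _ α :=
  DoubleDualComparison.equiv_contraExt (comparison γ) (comparison_compatible γ) _
    (fun f => by rw [comparison_zero, comparisonZero_mk₀]) α

end DegreeZero

/-! ### Compatibility with corestriction -/

section Corestriction

open Module Abelian Opposite

variable {k C C' : Type u} [Field k] [AddCommGroup C] [Module k C] [Coalgebra k C]
  [AddCommGroup C'] [Module k C'] [Coalgebra k C']

/-- Corestriction along a coalgebra homomorphism commutes with dualization. -/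
def dualCorestrictIso (f : C →ₗc[k] C') (N : RightComod k C) :
    (dualFunctor k C').obj (op ((comodCorestrict f).obj N)) ≅
      (contraCorestrict f).obj ((dualFunctor k C).obj (op N)) :=
  have h (g : C' →ₗ[k] Dual k N.carrier) :
      (N.corestrict f).dualContra g = N.dualContra (g ∘ₗ f.toLinearMap) := by
    apply LinearMap.ext
    intro (n : N.carrier)
    change TensorProduct.lift g.flip (f.toLinearMap.lTensor N.carrier (N.coact n)) =
      TensorProduct.lift (g ∘ₗ f.toLinearMap).flip (N.coact n)
    generalize N.coact n = x
    induction x with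
    | zero => simp
    | tmul a b => rfl
    | add x y hx hy => simp only [map_add, hx, hy]
  { hom := LeftContra.homMk (P := (N.corestrict f).dual) (Q := N.dual.corestrict f)
      (LinearMap.id : Dual k N.carrier →ₗ[k] Dual k N.carrier) h
    inv := LeftContra.homMk (Q := (N.corestrict f).dual) (P := N.dual.corestrict f)
      (LinearMap.id : Dual k N.carrier →ₗ[k] Dual k N.carrier) (fun g => (h g).symm)
    hom_inv_id := rfl
    inv_hom_id := rfl }

lemma dualCorestrictIso_naturality (f : C →ₗc[k] C') {N N' : RightComod k C} (g : N ⟶ N') :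
    (dualFunctor k C').map ((comodCorestrict f).map g).op ≫ (dualCorestrictIso f N).hom =
      (dualCorestrictIso f N').hom ≫ (contraCorestrict f).map ((dualFunctor k C).map g.op) := rfl

variable (γ : k →ₗc[k] C) (γ' : k →ₗc[k] C') (f : C →ₗc[k] C') (h : f.comp γ = γ')

/-- The map `Ext^n(k, N) → Ext^n(k, N)` from `C`-comodules to `C'`-comodules given by
corestriction. -/
noncomputable def comodExtMapTo (N : RightComod k C) (n : ℕ) :
    Ext (trivComod γ) N n →ₗ[k] Ext (trivComod γ') ((comodCorestrict f).obj N) n :=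
  (Ext.mk₀ (comodCorestrictTriv γ γ' f h).inv).precompOfLinear k _ (zero_add n) ∘ₗ
    (comodCorestrict f).mapExtLinearMap k _ _ n

/-- The map `Ext^n(N*, k) → Ext^n(N*, k)` from `C`-contramodules to `C'`-contramodules given by
corestriction. -/
noncomputable def contraExtMapFrom (N : RightComod k C) (n : ℕ)
    (ξ : Ext ((dualFunctor k C).obj (op N)) (trivContra γ) n) :
    Ext ((dualFunctor k C').obj (op ((comodCorestrict f).obj N))) (trivContra γ') n :=
  (Ext.mk₀ (dualCorestrictIso f N).hom).comp ((ξ.mapExactFunctor (contraCorestrict f)).comp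
    (Ext.mk₀ (contraCorestrictTriv γ γ' f h).hom) (add_zero n)) (zero_add n)

lemma comodExtMapTo_mk₀ {N : RightComod k C} (g : trivComod γ ⟶ N) :
    comodExtMapTo γ γ' f h N 0 (Ext.mk₀ g) =
      Ext.mk₀ ((comodCorestrictTriv γ γ' f h).inv ≫ (comodCorestrict f).map g) := by
  change (Ext.mk₀ _).comp ((Ext.mk₀ g).mapExactFunctor (comodCorestrict f)) (zero_add 0) = _
  rw [Ext.mapExactFunctor_mk₀, Ext.mk₀_comp_mk₀]

lemma comodExtMapTo_comp {N N' : RightComod k C} {a b c : ℕ} (α : Ext (trivComod γ) N a)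
    (β : Ext N N' b) (hc : a + b = c) :
    comodExtMapTo γ γ' f h N' c (α.comp β hc) =
      (comodExtMapTo γ γ' f h N a α).comp (β.mapExactFunctor (comodCorestrict f)) hc := by
  change (Ext.mk₀ _).comp ((α.comp β hc).mapExactFunctor (comodCorestrict f)) (zero_add c) =
    ((Ext.mk₀ _).comp (α.mapExactFunctor (comodCorestrict f)) (zero_add a)).comp _ hc
  rw [Ext.mapExactFunctor_comp, Ext.comp_assoc _ _ _ (zero_add a) hc (by lia)]

/-- Corestriction of contramodules, precomposed with the identification of the duals, commutes with
the connecting maps. -/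
lemma contraExtMapFrom_extClass_comp {N M L : RightComod k C} {i : N ⟶ M} {p : M ⟶ L}
    {w : i ≫ p = 0} {w' : (comodCorestrict f).map i ≫ (comodCorestrict f).map p = 0}
    (hS : (ShortComplex.mk i p w).ShortExact)
    (hS' : (ShortComplex.mk ((comodCorestrict f).map i) ((comodCorestrict f).map p) w').ShortExact)
    {n : ℕ} (ξ : Ext ((dualFunctor k C).obj (op L)) (trivContra γ) n) :
    contraExtMapFrom γ γ' f h N (n + 1)
        ((shortExact_contra (dualFunctor k C) hS).extClass.comp ξ (add_comm 1 n)) =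
      (shortExact_contra (dualFunctor k C') hS').extClass.comp
        (contraExtMapFrom γ γ' f h L n ξ) (add_comm 1 n) := by
  have hS₁ := shortExact_contra (dualFunctor k C) hS
  have hS₂ : (ShortComplex.mk ((contraCorestrict f).map ((dualFunctor k C).map p.op))
      ((contraCorestrict f).map ((dualFunctor k C).map i.op))
      (by rw [← Functor.map_comp, ← Functor.map_comp, ← op_comp, w, op_zero, Functor.map_zero,
        Functor.map_zero])).ShortExact :=
    hS₁.map_of_exact (contraCorestrict f)
  have e₁ : hS₁.extClass.mapExactFunctor (contraCorestrict f) = hS₂.extClass :=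
    Ext.mapExactFunctor_extClass _ _
  have e₂ := ShortComplex.ShortExact.extClass_naturality (shortExact_contra (dualFunctor k C') hS')
    hS₂
    { τ₁ := (dualCorestrictIso f L).hom
      τ₂ := (dualCorestrictIso f M).hom
      τ₃ := (dualCorestrictIso f N).hom
      comm₁₂ := (dualCorestrictIso_naturality f p).symm
      comm₂₃ := (dualCorestrictIso_naturality f i).symm }
  dsimp at e₁ e₂
  rw [contraExtMapFrom, contraExtMapFrom, Ext.mapExactFunctor_comp, e₁,
    Ext.comp_assoc_of_third_deg_zero,
    ← Ext.comp_assoc _ _ _ (zero_add 1) (add_comm 1 n) (by lia), ← e₂,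
    Ext.comp_assoc_of_second_deg_zero]

/-- The comparison isomorphisms commute with corestriction. -/
lemma comparison_corestrict {n : ℕ} {N : RightComod k C}
    (ξ : Ext ((dualFunctor k C).obj (op N)) (trivContra γ) n) :
    (comparison γ' n).equiv _ (contraExtMapFrom γ γ' f h N n ξ) =
      (comodExtMapTo γ γ' f h N n).dualMap.dualMap ((comparison γ n).equiv N ξ) := by
  induction n generalizing N with
  | zero =>
    obtain ⟨g, rfl⟩ := (Ext.linearEquiv₀ (R := k)).symm.surjective ξ
    obtain ⟨T, rfl⟩ := (homDoubleDualEquiv γ N).surjective g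
    -- The map `Hom(k, N) → Hom(k, N)` given by corestriction of comodules: both sides
    -- of the identity take a functional `ψ` to the value of `T` at the composition of `ψ` with `r`.
    let r : (trivComod γ ⟶ N) →ₗ[k] (trivComod γ' ⟶ (comodCorestrict f).obj N) :=
      Linear.leftComp k _ (comodCorestrictTriv γ γ' f h).inv ∘ₗ (comodCorestrict f).mapLinearMap k
    have e : contraExtMapFrom γ γ' f h N 0
        ((Ext.linearEquiv₀ (R := k)).symm (homDoubleDualEquiv γ N T)) =
        Ext.mk₀ (homOfDoubleDual γ' _ (r.dualMap.dualMap T)) := by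
      rw [Ext.linearEquiv₀_symm_apply, contraExtMapFrom, Ext.mapExactFunctor_mk₀,
        Ext.mk₀_comp_mk₀, Ext.mk₀_comp_mk₀]
      rfl
    rw [e, comparison_zero, comparison_zero, Ext.linearEquiv₀_symm_apply]
    refine (extZeroEquiv_mk₀ γ' _ _).trans
      (Eq.trans ?_ (congrArg _ (extZeroEquiv_mk₀ γ N T)).symm)
    apply LinearMap.ext
    intro ψ
    refine congrArg T (LinearMap.ext fun g => congrArg ψ ?_)
    exact (comodExtMapTo_mk₀ γ γ' f h g).symm
  | succ n ih =>
    obtain ⟨J, i, _, _, _⟩ := exists_mono_injective_projective N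
    have hS : (ShortComplex.mk i _ (cokernel.condition i)).ShortExact :=
      { exact := ShortComplex.exact_cokernel i }
    have hS' : (ShortComplex.mk ((comodCorestrict f).map i) ((comodCorestrict f).map (cokernel.π i))
      ((ShortComplex.mk i _ (cokernel.condition i)).map (comodCorestrict f)).zero).ShortExact :=
      hS.map_of_exact (comodCorestrict f)
    obtain ⟨ξ, rfl⟩ := Ext.exists_extClass_comp_of_projective
      (shortExact_contra (dualFunctor k C) hS) ξ
    rw [contraExtMapFrom_extClass_comp γ γ' f h hS hS', comparison_compatible,
      comparison_compatible, ih]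
    apply LinearMap.ext
    intro ψ
    refine congrArg ((comparison γ n).equiv _ ξ) (LinearMap.ext fun α => congrArg ψ ?_)
    refine ((comodExtMapTo_comp γ γ' f h α hS.extClass rfl).trans ?_).symm
    rw [Ext.mapExactFunctor_extClass]
    rfl

/-! ### The isomorphism -/

/-- The isomorphism `Ext^n(k, k) ≃ Ext^n(k, k)**` between the contramodule Ext space and the double
dual of the comodule Ext space. -/
noncomputable def contraExtEquiv (n : ℕ) :
    ContraExt γ n ≃ₗ[k] Dual k (Dual k (ComodExt γ n)) :=
  LinearEquiv.ofLinearMap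
    ((Ext.mk₀ (trivIso γ).inv).precompOfLinear k (trivContra γ) (zero_add n))
    ((Ext.mk₀ (trivIso γ).hom).precompOfLinear k (trivContra γ) (zero_add n))
    (LinearMap.ext fun ξ => by
      change (Ext.mk₀ (trivIso γ).inv).comp ((Ext.mk₀ (trivIso γ).hom).comp ξ (zero_add n))
        (zero_add n) = ξ
      rw [Ext.mk₀_comp_mk₀_assoc, Iso.inv_hom_id, Ext.mk₀_id_comp])
    (LinearMap.ext fun ξ => by
      change (Ext.mk₀ (trivIso γ).hom).comp ((Ext.mk₀ (trivIso γ).inv).comp ξ (zero_add n))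
        (zero_add n) = ξ
      rw [Ext.mk₀_comp_mk₀_assoc, Iso.hom_inv_id, Ext.mk₀_id_comp]) ≪≫ₗ
  (comparison γ n).equiv (trivComod γ)

lemma contraExtEquiv_apply {n : ℕ} (ξ : ContraExt γ n) : contraExtEquiv γ n ξ =
    (comparison γ n).equiv (trivComod γ) ((Ext.mk₀ (trivIso γ).inv).comp ξ (zero_add n)) := rfl

lemma contraExtEquiv_dualizationExt {n : ℕ} (α : ComodExt γ n) :
    contraExtEquiv γ n (dualizationExt γ n α) = Dual.eval k (ComodExt γ n) α := by
  rw [← comparison_contraExt γ α, contraExtEquiv_apply]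
  congr 1
  change (Ext.mk₀ (trivIso γ).inv).comp ((Ext.mk₀ (trivIso γ).hom).comp
    ((contraExt (dualFunctor k C) _ _ n α).comp (Ext.mk₀ (trivIso γ).inv) (add_zero n))
      (zero_add n)) (zero_add n) = _
  rw [Ext.mk₀_comp_mk₀_assoc, Iso.inv_hom_id, Ext.mk₀_id_comp]

lemma contraExtEquiv_contraExtMap {n : ℕ} (ξ : ContraExt γ n) :
    contraExtEquiv γ' n (contraExtMap γ γ' f h n ξ) =
      (comodExtMap γ γ' f h n).dualMap.dualMap (contraExtEquiv γ n ξ) := by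
  have e : (comodExtMap γ γ' f h n).dualMap.dualMap (contraExtEquiv γ n ξ) =
      extDoubleDualMap k (trivComod γ') (Ext.mk₀ (comodCorestrictTriv γ γ' f h).hom) (add_zero n)
        ((comodExtMapTo γ γ' f h (trivComod γ) n).dualMap.dualMap (contraExtEquiv γ n ξ)) := by
    apply LinearMap.ext
    intro ψ
    refine congrArg (contraExtEquiv γ n ξ) (LinearMap.ext fun α => congrArg ψ ?_)
    exact (Ext.comp_assoc_of_third_deg_zero _ _ _ (zero_add n)).symm
  rw [e, contraExtEquiv_apply, contraExtEquiv_apply, ← comparison_corestrict,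
    ← (comparison γ' n).naturality]
  congr 1
  rw [contraExtMapFrom, Ext.mapExactFunctor_comp, Ext.mapExactFunctor_mk₀,
    Ext.comp_assoc_of_third_deg_zero, Ext.mk₀_comp_mk₀_assoc, Ext.mk₀_comp_mk₀_assoc]
  exact Ext.mk₀_comp_mk₀_assoc _ _ _

end Corestriction

theorem mainTheorem8 (k : Type u) [Field k] :
    ∃ Φ : ∀ (C : Type u) [AddCommGroup C] [Module k C] [Coalgebra k C] (γ : k →ₗc[k] C) (n : ℕ),
        ContraExt γ n ≃ₗ[k] Module.Dual k (Module.Dual k (ComodExt γ n)),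
      (∀ (C : Type u) [AddCommGroup C] [Module k C] [Coalgebra k C] (γ : k →ₗc[k] C) (n : ℕ)
        (α : ComodExt γ n), Φ C γ n (dualizationExt γ n α) = Module.Dual.eval k (ComodExt γ n) α) ∧
      (∀ (C C' : Type u) [AddCommGroup C] [Module k C] [Coalgebra k C]
        [AddCommGroup C'] [Module k C'] [Coalgebra k C'] (γ : k →ₗc[k] C) (γ' : k →ₗc[k] C')
        (f : C →ₗc[k] C') (h : f.comp γ = γ') (n : ℕ) (ξ : ContraExt γ n),
        Φ C' γ' n (contraExtMap γ γ' f h n ξ) =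
          (comodExtMap γ γ' f h n).dualMap.dualMap (Φ C γ n ξ)) :=
  ⟨fun _ _ _ _ γ n => contraExtEquiv γ n, fun _ _ _ _ γ _ α => contraExtEquiv_dualizationExt γ α,
    fun _ _ _ _ _ _ _ _ γ γ' f h _ ξ => contraExtEquiv_contraExtMap γ γ' f h ξ⟩
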